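/- **Notation.** A *time warping* is a map $\gamma:[0,1]\to[0,1]$ with $\gamma(0)=0$, $\gamma(1)=1$ that is differentiable with $0<\dot\gamma<\infty$ on $[0,1]$; its *SRVF* is $\sqrt{\dot\gamma}$. Write $(g;\gamma)=(g\circ\gamma)\,\dot\gamma$ and $\|g\|=(\int_0^1 g^2)^{1/2}$. Let $\mathbb P$ be the set of (a.e.) positive probability densities on $[0,1]$. For $g_1,g_2\in\mathbb P$ with distribution functions $G_1,G_2$ put $d_{ext}(g_1,g_2)=\|1-\sqrt{\dot\gamma^*}\|$, where $\gamma^*=G_2^{-1}\circ G_1$. A *Karcher mean* of $g_1,\dots,g_n\in\mathbb P$ is a minimizer of $\mu\mapsto\sum_{i=1}^n d_{ext}(\mu,g_i)^2$ over $\mathbb P$. **Estimator.** Let $K\ge 0$ be a measurable kernel with $\int K=1$ and $K(t)=0$ for $|t|>1$, and let $(h_r)_r$ be bandwidths. From $r$ observations $x_1,\dots,x_r\in[0,1]$ form $\tilde f(t)=\frac1{rh_r}\sum_{j=1}^rK\big(\frac{t-x_j}{h_r}\big)$, then $\tilde{\tilde f}(t)=\tilde f(t)+\tilde f(-t)+\tilde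 f(2-t)$ and the *modified kernel estimate* $\frac{r}{r+1}\tilde{\tilde f}(t)+\frac1{r+1}$, $t\in[0,1]$ (which is $1$ if $r=0$). Given $n$ observed processes $S_1,\dots,S_n$, let $\hat f_i$ be the modified kernel estimate from the events of $S_i$, with distribution function $\hat F_i$. Choose any $j_0\in\{1,\dots,n\}$, put $\gamma_j^*=\hat F_{j_0}^{-1}\circ\hat F_j$, define the warping $\bar\gamma$ by $$\sqrt{\dot{\bar\gamma}}=\frac{\sum_{j}\sqrt{\tfrac{d}{dt}(\gamma_j^*)^{-1}}}{\big\|\sum_{j}\sqrt{\tfrac{d}{dt}(\gamma_j^*)^{-1}}\big\|},\qquad \bar\gamma(0)=0,$$ and let the density estimate be $\hat f=(\hat f_{j_0};\bar\gamma^{-1})$. **Assumptions.** 1. $f$ is a continuous probability density on $[0,1]$ with $0<m_f\le f\le M_f<\infty$. 2. $\gamma_1,\gamma_2,\dots$ are independent random time warpings, and there are constants $\beta,m_\gamma,M_\gamma>0$ such that, for all $i$ and all $t\in[0,1]$, $\mathbb E\sqrt{\tfrac{d}{dt}\gamma_i^{-1}(t)}=\beta$, and almost surely $\sqrt{\tfrac{d}{dt}\gamma_i^{-1}(t)}\in[m_\gamma,M_\gamma]$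 for all $i$ and $t$. 3. $\Lambda_m>0$ are total intensities with $\Lambda_m\ge\alpha\log m$ for all sufficiently large $m$, where $\alpha>1$; the intensity at stage $m$ is $\lambda^{(m)}=\Lambda_m f$. 4. For all $i,m$, given $\gamma_i$, the observation $S_i^{(m)}$ is a realization of a Poisson process on $[0,1]$ with intensity $\lambda_i^{(m)}=(\lambda^{(m)}\circ\gamma_i)\,\dot\gamma_i$. For each $i$ the event times of $S_i^{(m)}$, $m\ge1$, are the first $N_i^{(m)}=|S_i^{(m)}|$ terms of one sequence $X_{i,1},X_{i,2},\dots$ which, given $\gamma_i$, is i.i.d. with density $f_i=(f;\gamma_i)$. (The joint law of the counts $N_i^{(m)}$ over different $m$ is arbitrary.) 5. $h_r\to0$ and $rh_r\to\infty$ as $r\to\infty$. **Theorem.** Let $\hat f_{n,m}$ be the density estimate computed from $S_1^{(m)},\dots,S_n^{(m)}$. Then almost surely: for every $n\ge1$ and all sufficiently large $m$, $\hat f_{n,m}$ is a Karcher mean of the $n$ modified kernel estimates, for every choice of $j_0$; and $$\lim_{n\to\infty}\ \lim_{m\to\infty} d_{ext}(\hat f_{n,m},f)=0,$$ where, for every $n\ge1$,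 the inner limit exists and does not depend on the choices of $j_0$ (which may vary with $m$). -/

import Mathlib

open MeasureTheory ProbabilityTheory Filter Topology Set

noncomputable section

/-! ### Time warpings of `[0, 1]` -/

/-- The group `Γ` of time warpings: `γ(0) = 0`, `γ(1) = 1` and `0 < γ̇ < ∞` on `[0, 1]`
(one-sided derivatives at the end points). Only the values on `[0, 1]` matter. -/
structure IsWarp (γ : ℝ → ℝ) : Prop where
  map_zero : γ 0 = 0
  map_one : γ 1 = 1
  deriv_pos : ∀ t ∈ Icc (0 : ℝ) 1, ∃ d : ℝ, 0 < d ∧ HasDerivWithinAt γ d (Icc 0 1) t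

/-- The derivative `γ̇` on `[0, 1]`. -/
def warpDeriv (γ : ℝ → ℝ) (t : ℝ) : ℝ := derivWithin γ (Icc 0 1) t

/-- The inverse `γ⁻¹` of a bijection `γ` of `[0, 1]`. -/
def warpInv (γ : ℝ → ℝ) : ℝ → ℝ := Function.invFunOn γ (Icc 0 1)

/-- The square-root velocity function `√γ̇`. -/
def srvf (γ : ℝ → ℝ) (t : ℝ) : ℝ := Real.sqrt (warpDeriv γ t)

/-- The area-preserving action `(g; γ) = (g ∘ γ) γ̇`. -/
def areaAct (g γ : ℝ → ℝ) (t : ℝ) : ℝ := g (γ t) * warpDeriv γ t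

/-- The `L²` norm on `[0, 1]`. -/
def l2Norm (g : ℝ → ℝ) : ℝ := Real.sqrt (∫ t in (0 : ℝ)..1, g t ^ 2)

/-! ### Positive densities, the phase distance and Karcher means -/

/-- The set `ℙ` of positive probability densities on `[0, 1]`; as usual for densities,
positivity is required almost everywhere. -/
structure IsPosDensity (g : ℝ → ℝ) : Prop where
  integrable : IntegrableOn g (Icc 0 1)
  pos : ∀ᵐ t ∂(volume.restrict (Icc (0 : ℝ) 1)), 0 < g t
  integral_eq_one : ∫ t in (0 : ℝ)..1, g t = 1

/-- The cumulative distribution function on `[0, 1]`. -/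
def cdfOf (g : ℝ → ℝ) (t : ℝ) : ℝ := ∫ s in (0 : ℝ)..t, g s

/-- The optimal warping `γ* = F₂⁻¹ ∘ F₁` between two densities, i.e. `F₁ = F₂ ∘ γ*`. -/
def optWarp (g₁ g₂ : ℝ → ℝ) : ℝ → ℝ := warpInv (cdfOf g₂) ∘ cdfOf g₁

/-- The extrinsic phase distance `d_ext(g₁, g₂) = ‖1 - √γ̇*‖`. -/
def dExt (g₁ g₂ : ℝ → ℝ) : ℝ := l2Norm (fun t => 1 - srvf (optWarp g₁ g₂) t)

/-- `μ` minimizes `∑ d_ext(μ, gᵢ)²` over the positive densities. -/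
def IsKarcherMean {n : ℕ} (g : Fin n → ℝ → ℝ) (μ : ℝ → ℝ) : Prop :=
  IsPosDensity μ ∧
    ∀ ν : ℝ → ℝ, IsPosDensity ν → ∑ i, dExt μ (g i) ^ 2 ≤ ∑ i, dExt ν (g i) ^ 2

/-- The sum `∑ⱼ √(d/dt (γⱼ*)⁻¹)`, where `γⱼ* = F₀⁻¹ ∘ Fⱼ` and `F₀` is the distribution function
of the initial density `g j₀`. -/
def karcherSum {n : ℕ} (g : Fin n → ℝ → ℝ) (j₀ : Fin n) (t : ℝ) : ℝ :=
  ∑ j, srvf (warpInv (optWarp (g j) (g j₀))) t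

/-- The warping `γ̄` with `√(dγ̄/dt) = ∑ⱼ √(d/dt (γⱼ*)⁻¹) / ‖∑ⱼ √(d/dt (γⱼ*)⁻¹)‖`. -/
def karcherWarp {n : ℕ} (g : Fin n → ℝ → ℝ) (j₀ : Fin n) (t : ℝ) : ℝ :=
  ∫ s in (0 : ℝ)..t, (karcherSum g j₀ s / l2Norm (karcherSum g j₀)) ^ 2

/-- The Karcher mean algorithm started at `g j₀`; its output is the density
`(g j₀ ∘ γ̄⁻¹) · d/dt γ̄⁻¹`. -/
def karcherAlg {n : ℕ} (g : Fin n → ℝ → ℝ) (j₀ : Fin n) : ℝ → ℝ :=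
  areaAct (g j₀) (warpInv (karcherWarp g j₀))

/-! ### Kernel estimation -/

/-- The standard kernel estimate `(1 / (r h)) ∑ K((t - x) / h)` from `r` observations. -/
def kernelEst (K : ℝ → ℝ) (h : ℝ) (x : Multiset ℝ) (t : ℝ) : ℝ :=
  1 / (Multiset.card x * h) * (x.map fun y => K ((t - y) / h)).sum

/-- The estimate with the parts outside `[0, 1]` reflected into `[0, 1]`. -/
def reflectedEst (K : ℝ → ℝ) (h : ℝ) (x : Multiset ℝ) (t : ℝ) : ℝ :=
  kernelEst K h x t + kernelEst K h x (-t) + kernelEst K h x (2 - t)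

/-- The modified kernel estimate from `r` observations with bandwidth `h r`. -/
def modifiedEst (K : ℝ → ℝ) (h : ℕ → ℝ) (x : Multiset ℝ) (t : ℝ) : ℝ :=
  reflectedEst K (h (Multiset.card x)) x t * (Multiset.card x / (Multiset.card x + 1))
    + 1 / (Multiset.card x + 1)

/-- The density estimate computed from the event times of `n` observed processes; `j₀` is the
process whose estimated density initializes the Karcher mean algorithm. -/
def densityEst (K : ℝ → ℝ) (h : ℕ → ℝ) {n : ℕ} (S : Fin n → Multiset ℝ) (j₀ : Fin n) : ℝ → ℝ :=
  karcherAlg (fun i => modifiedEst K h (S i)) j₀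

/-! ### Random warpings and Poisson processes -/

/-- The path `t ↦ γ(t)`, `t ∈ [0, 1]`, of a random warping. -/
def warpPath {Ω : Type*} (γ : Ω → ℝ → ℝ) (ω : Ω) (t : Icc (0 : ℝ) 1) : ℝ := γ ω t

/-- The `σ`-algebra generated by a random warping. -/
abbrev warpSigma {Ω : Type*} (γ : Ω → ℝ → ℝ) : MeasurableSpace Ω :=
  MeasurableSpace.comap (warpPath γ) inferInstance

open Classical in
/-- The number of points of a finite configuration in a set. -/
def countIn (x : Multiset ℝ) (A : Set ℝ) : ℕ := x.countP (· ∈ A)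

/-- Conditionally on `𝒢`, the random finite configuration `S` is a Poisson process on `[0, 1]` with
the (`𝒢`-measurable) intensity function `lam`: the numbers of events in disjoint intervals
are conditionally independent, and the number of events in an interval `A` is Poisson distributed
with mean `∫_A lam`. -/
structure IsPoissonProcessGiven {Ω : Type*} (𝒢 : MeasurableSpace Ω)
    [MeasurableSpace Ω] (P : Measure Ω) (S : Ω → Multiset ℝ) (lam : Ω → ℝ → ℝ) : Prop where
  measurable_count : ∀ A : Set ℝ, A.OrdConnected → Measurable fun ω => countIn (S ω) A
  mem_Icc : ∀ᵐ ω ∂P, ∀ x ∈ S ω, x ∈ Icc (0 : ℝ) 1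
  law : ∀ (p : ℕ) (A : Fin p → Set ℝ), (∀ l, (A l).OrdConnected) → (∀ l, A l ⊆ Icc 0 1) →
    (∀ l l', l ≠ l' → Disjoint (A l) (A l')) → ∀ k : Fin p → ℕ,
    P⟦{ω | ∀ l, countIn (S ω) (A l) = k l} | 𝒢⟧ =ᵐ[P]
      fun ω => ∏ l, Real.exp (-∫ t in A l, lam ω t) * (∫ t in A l, lam ω t) ^ k l
        / (Nat.factorial (k l) : ℝ)

/-- Conditionally on `𝒢`, the random variables `X 0, X 1, …` are i.i.d. with the
(`𝒢`-measurable) probability density `g` on `[0, 1]`. -/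
structure IsIIDGiven {Ω : Type*} (𝒢 : MeasurableSpace Ω)
    [MeasurableSpace Ω] (P : Measure Ω) (X : ℕ → Ω → ℝ) (g : Ω → ℝ → ℝ) : Prop where
  measurable : ∀ j, Measurable (X j)
  law : ∀ (r : ℕ) (t : ℕ → ℝ), (∀ j, t j ∈ Icc (0 : ℝ) 1) →
    P⟦{ω | ∀ j < r, X j ω ≤ t j} | 𝒢⟧ =ᵐ[P]
      fun ω => ∏ j ∈ Finset.range r, ∫ s in (0 : ℝ)..t j, g ω s

end

/-! Everything is moved into the Hilbert space `L²[0, 1]`. To a positive density `g` with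
distribution function `G` corresponds the square root `q` of its quantile density, `q² = (G⁻¹)'`, a
unit vector (`rootVec`). A distribution function `Φ` with density `φ` acts isometrically by `ψ ↦ √φ
· (ψ ∘ Φ)` (`HasDens.eLpNorm_rootAct`). Acting by the distribution function of `ν` sends the root of
`ν` to the constant `1` and the root of `g` to `√γ̇*`, so `dExt ν g` is the chordal distance of the
two unit vectors (`IsPosDensity.dExt_eq_norm`). A sum of squared chordal distances to unit vectors
is minimized on the sphere by their normalized sum. Here that vector is a.e. positive, hence again
the root of a density, and the algorithm returns exactly this density (`rootVec_karcherAlg`),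
whatever the starting density `g j₀`.

For fixed `n` and `m → ∞`, the counts tend to infinity by Borel–Cantelli (`ae_tendsto_card`), and
the kernel estimates converge in `L¹` (`tendsto_integral_modifiedEst_sub`). The latter rests on
smoothing: after convolution with a kernel of bandwidth `h`, only the masses of cells of length `h /
p` matter. There are about `p / h = o(r)` cells, so a union bound over all unions of cells costs `2
^ o(r)`, which Hoeffding's inequality, applied conditionally on the warping, absorbs. `L¹`
convergence of densities gives `L²` convergence of their roots (`IsPosDensity.tendsto_rootVec`), and
the normalized sums converge.

For `n → ∞`, the isometric action of the distribution function of `f` sends the root of `(f; γᵢ)` to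
`√(d/dt γᵢ⁻¹)` and the root of `f` to `1`. The strong law at each `t`, Fubini and dominated
convergence show that the averages of these functions tend in `L²` to the constant `β`. Hence the
averaged roots tend to `β` times the root of `f`, and normalization removes `β`. -/

noncomputable section

/-! ### Distribution functions of positive densities -/

/-- Lebesgue measure on the unit interval. -/
abbrev unitVol : Measure ℝ := volume.restrict (Icc (0 : ℝ) 1)

instance isProbabilityMeasure_unitVol : IsProbabilityMeasure unitVol :=
  ⟨by simp⟩

theorem ae_mem_unit : ∀ᵐ t ∂unitVol, t ∈ Icc (0 : ℝ) 1 :=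
  ae_restrict_mem measurableSet_Icc

theorem integral_unitVol (g : ℝ → ℝ) : ∫ t, g t ∂unitVol = ∫ t in (0 : ℝ)..1, g t := by
  rw [intervalIntegral.integral_of_le zero_le_one, integral_Icc_eq_integral_Ioc]

theorem cdfOf_eq_integral_indicator (g : ℝ → ℝ) {t : ℝ} (ht : t ∈ Icc (0 : ℝ) 1) :
    cdfOf g t = ∫ s, (Iic t).indicator g s ∂unitVol := by
  have : Iic t ∩ Icc (0 : ℝ) 1 = Icc 0 t := by
    ext x; simp only [mem_inter_iff, mem_Iic, mem_Icc] at ht ⊢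
    constructor
    · rintro ⟨h1, h2, -⟩; exact ⟨h2, h1⟩
    · rintro ⟨h1, h2⟩; exact ⟨h2, h1, h2.trans ht.2⟩
  rw [cdfOf, intervalIntegral.integral_of_le ht.1, integral_indicator measurableSet_Iic,
    Measure.restrict_restrict measurableSet_Iic, this, integral_Icc_eq_integral_Ioc]

theorem cdfOf_congr_ae {g g' : ℝ → ℝ} (h : g =ᵐ[unitVol] g') :
    EqOn (cdfOf g) (cdfOf g') (Icc 0 1) := by
  intro t ht
  rw [cdfOf_eq_integral_indicator g ht, cdfOf_eq_integral_indicator g' ht]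
  apply integral_congr_ae
  filter_upwards [h] with s hs
  by_cases hst : s ∈ Iic t
  · rw [indicator_of_mem hst, indicator_of_mem hst, hs]
  · rw [indicator_of_notMem hst, indicator_of_notMem hst]

/-- The measure on the unit interval with density `g`. -/
def densMeasure (g : ℝ → ℝ) : Measure ℝ := unitVol.withDensity fun t => ENNReal.ofReal (g t)

namespace IsPosDensity

variable {g : ℝ → ℝ}

theorem congr_ae {g' : ℝ → ℝ} (hg : IsPosDensity g) (h : g =ᵐ[unitVol] g') : IsPosDensity g' where
  integrable := hg.integrable.congr h
  pos := by filter_upwards [hg.pos, h] with t h1 h2; rwa [← h2]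
  integral_eq_one := by
    rw [← integral_unitVol, ← integral_congr_ae h, integral_unitVol, hg.integral_eq_one]

theorem aemeasurable (hg : IsPosDensity g) : AEMeasurable g unitVol :=
  hg.integrable.aestronglyMeasurable.aemeasurable

theorem intervalIntegrable (hg : IsPosDensity g) {s t : ℝ} (hs : s ∈ Icc (0 : ℝ) 1)
    (ht : t ∈ Icc (0 : ℝ) 1) : IntervalIntegrable g volume s t := by
  rw [intervalIntegrable_iff]
  exact hg.integrable.mono_set (uIoc_subset_uIcc.trans (uIcc_subset_Icc hs ht))

theorem cdf_zero : cdfOf g 0 = 0 := by simp [cdfOf]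

theorem cdf_one (hg : IsPosDensity g) : cdfOf g 1 = 1 := hg.integral_eq_one

theorem continuousOn_cdf (hg : IsPosDensity g) : ContinuousOn (cdfOf g) (Icc 0 1) := by
  have := intervalIntegral.continuousOn_primitive_interval (μ := volume) (f := g) (a := 0) (b := 1)
    (by rw [uIcc_of_le zero_le_one]; exact hg.integrable)
  rwa [uIcc_of_le zero_le_one] at this

theorem strictMonoOn_cdf (hg : IsPosDensity g) : StrictMonoOn (cdfOf g) (Icc 0 1) := by
  intro s hs t ht hst
  have h0 : (0 : ℝ) ∈ Icc (0 : ℝ) 1 := by simp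
  have hsub : cdfOf g t - cdfOf g s = ∫ x in s..t, g x :=
    intervalIntegral.integral_interval_sub_left (hg.intervalIntegrable h0 ht)
      (hg.intervalIntegrable h0 hs)
  have hss : Ioc s t ⊆ Icc 0 1 := fun x hx => ⟨hs.1.trans hx.1.le, hx.2.trans ht.2⟩
  have hpos : ∀ᵐ x ∂volume.restrict (Ioc s t), 0 < g x :=
    ae_restrict_of_ae_restrict_of_subset hss hg.pos
  have : 0 < ∫ x in s..t, g x := by
    rw [intervalIntegral.integral_of_le hst.le,
      integral_pos_iff_support_of_nonneg_ae (hpos.mono fun x hx => hx.le)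
        (hg.integrable.mono_set hss)]
    have : volume.restrict (Ioc s t) (Function.support g) = volume.restrict (Ioc s t) univ := by
      apply measure_congr
      filter_upwards [hpos] with x hx
      exact propext ⟨fun _ => trivial, fun _ => hx.ne'⟩
    rw [this]
    simpa using hst
  linarith

theorem bijOn_cdf (hg : IsPosDensity g) : BijOn (cdfOf g) (Icc 0 1) (Icc 0 1) := by
  have h0 : (0 : ℝ) ∈ Icc (0 : ℝ) 1 := by simp
  have h1 : (1 : ℝ) ∈ Icc (0 : ℝ) 1 := by simp
  refine ⟨fun t ht => ?_, hg.strictMonoOn_cdf.injOn, ?_⟩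
  · have a := hg.strictMonoOn_cdf.monotoneOn h0 ht ht.1
    have b := hg.strictMonoOn_cdf.monotoneOn ht h1 ht.2
    rw [cdf_zero] at a; rw [hg.cdf_one] at b
    exact ⟨a, b⟩
  · have := intermediate_value_Icc zero_le_one hg.continuousOn_cdf
    rwa [cdf_zero, hg.cdf_one] at this

theorem integrable_densMeasure_iff (hg : IsPosDensity g) {F : ℝ → ℝ} :
    Integrable F (densMeasure g) ↔ Integrable (fun t => g t * F t) unitVol := by
  rw [densMeasure, integrable_withDensity_iff_integrable_smul₀' hg.aemeasurable.ennreal_ofReal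
    (by simp)]
  apply integrable_congr
  filter_upwards [hg.pos] with t ht
  simp [ENNReal.toReal_ofReal ht.le]

theorem integral_densMeasure (hg : IsPosDensity g) (F : ℝ → ℝ) :
    ∫ t, F t ∂densMeasure g = ∫ t, g t * F t ∂unitVol := by
  rw [densMeasure, integral_withDensity_eq_integral_toReal_smul₀ hg.aemeasurable.ennreal_ofReal
    (by simp)]
  apply integral_congr_ae
  filter_upwards [hg.pos] with t ht
  simp [ENNReal.toReal_ofReal ht.le]

theorem densMeasure_ac : densMeasure g ≪ unitVol := withDensity_absolutelyContinuous _ _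

theorem ac_densMeasure (hg : IsPosDensity g) : unitVol ≪ densMeasure g :=
  withDensity_absolutelyContinuous' hg.aemeasurable.ennreal_ofReal
    (by filter_upwards [hg.pos] with t ht; simpa using ht)

theorem densMeasure_Icc (hg : IsPosDensity g) {t : ℝ} (ht : t ∈ Icc (0 : ℝ) 1) :
    densMeasure g (Icc 0 t) = ENNReal.ofReal (cdfOf g t) := by
  have hsub : Icc 0 t ⊆ Icc (0 : ℝ) 1 := Icc_subset_Icc_right ht.2
  rw [densMeasure, withDensity_apply _ measurableSet_Icc, cdfOf,
    Measure.restrict_restrict measurableSet_Icc, inter_eq_left.2 hsub,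
    intervalIntegral.integral_of_le ht.1, ← integral_Icc_eq_integral_Ioc,
    ofReal_integral_eq_lintegral_ofReal (hg.integrable.mono_set hsub)]
  exact ae_restrict_of_ae_restrict_of_subset hsub (hg.pos.mono fun x hx => hx.le)

theorem isProbabilityMeasure_densMeasure (hg : IsPosDensity g) :
    IsProbabilityMeasure (densMeasure g) := by
  constructor
  have h : densMeasure g (Icc 0 1) = 1 := by
    rw [hg.densMeasure_Icc (by simp), hg.cdf_one, ENNReal.ofReal_one]
  rw [← h]
  apply measure_congr
  filter_upwards [densMeasure_ac.ae_le ae_mem_unit] with t ht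
  exact propext ⟨fun _ => ht, fun _ => trivial⟩

end IsPosDensity

/-- `Φ` agrees on `[0, 1]` with the distribution function of the positive density `φ`. -/
structure HasDens (Φ φ : ℝ → ℝ) : Prop where
  isPosDensity : IsPosDensity φ
  eqOn : EqOn Φ (cdfOf φ) (Icc 0 1)

theorem IsPosDensity.hasDens {g : ℝ → ℝ} (hg : IsPosDensity g) : HasDens (cdfOf g) g :=
  ⟨hg, fun _ _ => rfl⟩

/-- Since `ψ` is only a.e. measurable, the composition needs control of preimages of null sets. The
pushforward is a separate variable `ν` so that it can be eliminated. -/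
theorem aemeasurable_comp_of_map_eq {μ ν : Measure ℝ} {Φ : ℝ → ℝ} {ψ : ℝ → ℝ}
    (hΦ : AEMeasurable Φ μ) (hm : μ.map Φ = ν) (hψ : AEMeasurable ψ ν) :
    AEMeasurable (fun t => ψ (Φ t)) μ := by
  subst hm
  exact hψ.comp_aemeasurable hΦ

namespace HasDens

variable {Φ φ : ℝ → ℝ}

theorem congr_ae {φ' : ℝ → ℝ} (h : HasDens Φ φ) (hφ : φ =ᵐ[unitVol] φ') : HasDens Φ φ' :=
  ⟨h.isPosDensity.congr_ae hφ, h.eqOn.trans (cdfOf_congr_ae hφ)⟩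

theorem congr {Φ' : ℝ → ℝ} (h : HasDens Φ φ) (hΦ : EqOn Φ Φ' (Icc 0 1)) : HasDens Φ' φ :=
  ⟨h.isPosDensity, hΦ.symm.trans h.eqOn⟩

theorem bijOn (h : HasDens Φ φ) : BijOn Φ (Icc 0 1) (Icc 0 1) :=
  h.isPosDensity.bijOn_cdf.congr h.eqOn.symm

theorem strictMonoOn (h : HasDens Φ φ) : StrictMonoOn Φ (Icc 0 1) :=
  h.isPosDensity.strictMonoOn_cdf.congr h.eqOn.symm

theorem continuousOn (h : HasDens Φ φ) : ContinuousOn Φ (Icc 0 1) :=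
  h.isPosDensity.continuousOn_cdf.congr h.eqOn

theorem aemeasurable (h : HasDens Φ φ) : AEMeasurable Φ unitVol :=
  h.continuousOn.aemeasurable measurableSet_Icc

theorem map_zero (h : HasDens Φ φ) : Φ 0 = 0 := by
  rw [h.eqOn (by simp), IsPosDensity.cdf_zero]

theorem map_one (h : HasDens Φ φ) : Φ 1 = 1 := by
  rw [h.eqOn (by simp), h.isPosDensity.cdf_one]

theorem invOn (h : HasDens Φ φ) : InvOn (warpInv Φ) Φ (Icc 0 1) (Icc 0 1) :=
  h.bijOn.invOn_invFunOn

theorem bijOn_warpInv (h : HasDens Φ φ) : BijOn (warpInv Φ) (Icc 0 1) (Icc 0 1) :=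
  (bijOn_comm h.invOn).2 h.bijOn

theorem strictMonoOn_warpInv (h : HasDens Φ φ) : StrictMonoOn (warpInv Φ) (Icc 0 1) := by
  intro s hs t ht hst
  rw [← h.strictMonoOn.lt_iff_lt (h.bijOn_warpInv.mapsTo hs) (h.bijOn_warpInv.mapsTo ht),
    h.invOn.2 hs, h.invOn.2 ht]
  exact hst

theorem aemeasurable_warpInv (h : HasDens Φ φ) : AEMeasurable (warpInv Φ) unitVol :=
  aemeasurable_restrict_of_monotoneOn measurableSet_Icc h.strictMonoOn_warpInv.monotoneOn

/-- The probability integral transform: a variable inserted into its own continuous distribution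
function becomes uniform. Half-lines determine both measures. This replaces every pointwise change
of variables below. -/
theorem map_densMeasure (h : HasDens Φ φ) : (densMeasure φ).map Φ = unitVol := by
  have := h.isPosDensity.isProbabilityMeasure_densMeasure
  have hΦ : AEMeasurable Φ (densMeasure φ) :=
    h.aemeasurable.mono_ac IsPosDensity.densMeasure_ac
  have hmem : ∀ᵐ t ∂densMeasure φ, t ∈ Icc (0 : ℝ) 1 :=
    IsPosDensity.densMeasure_ac.ae_le ae_mem_unit
  apply Measure.ext_of_Iic
  intro a
  rw [Measure.map_apply_of_aemeasurable hΦ measurableSet_Iic,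
    Measure.restrict_apply measurableSet_Iic]
  rcases lt_or_ge a 0 with ha | ha
  · have h1 : densMeasure φ (Φ ⁻¹' Iic a) = 0 := by
      rw [measure_eq_zero_iff_ae_notMem]
      filter_upwards [hmem] with t ht hta
      exact absurd ((h.bijOn.mapsTo ht).1.trans hta) (not_le.2 ha)
    have h2 : Iic a ∩ Icc 0 1 = ∅ := by
      ext x; simp only [mem_inter_iff, mem_Iic, mem_Icc, mem_empty_iff_false, iff_false]
      rintro ⟨h1, h2, -⟩; linarith
    rw [h1, h2, measure_empty]
  · have hmin : min a 1 ∈ Icc (0 : ℝ) 1 := ⟨le_min ha zero_le_one, min_le_right _ _⟩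
    obtain ⟨b, hb, hab⟩ := h.bijOn.surjOn hmin
    have h1 : densMeasure φ (Φ ⁻¹' Iic a) = densMeasure φ (Icc 0 b) := by
      apply measure_congr
      filter_upwards [hmem] with t ht
      apply propext
      change Φ t ≤ a ↔ 0 ≤ t ∧ t ≤ b
      rw [← h.strictMonoOn.le_iff_le ht hb, hab, le_min_iff]
      exact ⟨fun h' => ⟨ht.1, h', (h.bijOn.mapsTo ht).2⟩, fun h' => h'.2.1⟩
    have h2 : Iic a ∩ Icc 0 1 = Icc 0 (min a 1) := by
      ext x; simp only [mem_inter_iff, mem_Iic, mem_Icc, le_min_iff]; tauto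
    rw [h1, h2, h.isPosDensity.densMeasure_Icc hb, ← h.eqOn hb, hab, Real.volume_Icc, sub_zero]

/-- Positivity of `φ` is essential: it makes Lebesgue measure absolutely continuous with respect to
`densMeasure φ`, so preimages of null sets under `Φ` are null. -/
theorem ae_comp (h : HasDens Φ φ) {p : ℝ → Prop} (hp : ∀ᵐ s ∂unitVol, p s) :
    ∀ᵐ t ∂unitVol, p (Φ t) := by
  have hΦ : AEMeasurable Φ (densMeasure φ) :=
    h.aemeasurable.mono_ac IsPosDensity.densMeasure_ac
  rw [← h.map_densMeasure] at hp
  exact h.isPosDensity.ac_densMeasure.ae_le (ae_of_ae_map hΦ hp)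

theorem aemeasurable_comp (h : HasDens Φ φ) {ψ : ℝ → ℝ} (hψ : AEMeasurable ψ unitVol) :
    AEMeasurable (fun t => ψ (Φ t)) unitVol :=
  (aemeasurable_comp_of_map_eq (h.aemeasurable.mono_ac IsPosDensity.densMeasure_ac)
    h.map_densMeasure hψ).mono_ac h.isPosDensity.ac_densMeasure

theorem map_warpInv (h : HasDens Φ φ) : unitVol.map (warpInv Φ) = densMeasure φ := by
  have hΦ : AEMeasurable Φ (densMeasure φ) :=
    h.aemeasurable.mono_ac IsPosDensity.densMeasure_ac
  have hΨ : AEMeasurable (warpInv Φ) ((densMeasure φ).map Φ) := by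
    rw [h.map_densMeasure]; exact h.aemeasurable_warpInv
  conv_lhs => rw [← h.map_densMeasure]
  rw [AEMeasurable.map_map_of_aemeasurable hΨ hΦ]
  have : warpInv Φ ∘ Φ =ᵐ[densMeasure φ] id := by
    filter_upwards [IsPosDensity.densMeasure_ac.ae_le ae_mem_unit] with t ht
    exact h.invOn.1 ht
  rw [Measure.map_congr this, Measure.map_id]

theorem integrable_mul_comp (h : HasDens Φ φ) {F : ℝ → ℝ} (hF : Integrable F unitVol) :
    Integrable (fun t => φ t * F (Φ t)) unitVol := by
  have hΦ : AEMeasurable Φ (densMeasure φ) :=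
    h.aemeasurable.mono_ac IsPosDensity.densMeasure_ac
  rw [← h.isPosDensity.integrable_densMeasure_iff (F := fun t => F (Φ t))]
  rw [← h.map_densMeasure] at hF
  exact hF.comp_aemeasurable hΦ

theorem integral_mul_comp (h : HasDens Φ φ) {F : ℝ → ℝ} (hF : AEMeasurable F unitVol) :
    ∫ t, φ t * F (Φ t) ∂unitVol = ∫ s, F s ∂unitVol := by
  have hΦ : AEMeasurable Φ (densMeasure φ) :=
    h.aemeasurable.mono_ac IsPosDensity.densMeasure_ac
  have h1 : ∫ s, F s ∂unitVol = ∫ s, F s ∂((densMeasure φ).map Φ) := by rw [h.map_densMeasure]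
  rw [h1, integral_map hΦ (by rw [h.map_densMeasure]; exact hF.aestronglyMeasurable),
    h.isPosDensity.integral_densMeasure]

theorem ext_of_cdf {c C : ℝ → ℝ} (hint : Integrable c unitVol) (hpos : ∀ᵐ t ∂unitVol, 0 < c t)
    (hC : C 1 = 1) (h : ∀ t ∈ Icc (0 : ℝ) 1, ∫ s, (Iic t).indicator c s ∂unitVol = C t) :
    HasDens C c := by
  have heq : EqOn C (cdfOf c) (Icc 0 1) := fun t ht => by
    rw [cdfOf_eq_integral_indicator c ht, h t ht]
  exact ⟨⟨hint, hpos, (heq (by simp)).symm.trans hC⟩, heq⟩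

/-- The inverse of a distribution function is a distribution function. -/
theorem warpInv (h : HasDens Φ φ) : HasDens (warpInv Φ) (fun u => (φ (warpInv Φ u))⁻¹) := by
  have hφ := h.isPosDensity
  -- No differentiation is involved: `warpInv Φ` pushes the uniform law to the law with density `φ`,
  -- and `φ · φ⁻¹ = 1` leaves the length of `[0, t]`, `t = Φ⁻¹(u)`.
  have key : ∀ F : ℝ → ℝ, AEMeasurable F unitVol →
      ∫ u, F (_root_.warpInv Φ u) ∂unitVol = ∫ t, φ t * F t ∂unitVol := by
    intro F hF
    rw [← hφ.integral_densMeasure, ← h.map_warpInv, integral_map h.aemeasurable_warpInv]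
    rw [h.map_warpInv]
    exact (hF.mono_ac IsPosDensity.densMeasure_ac).aestronglyMeasurable
  have hinv : AEMeasurable (fun t => (φ t)⁻¹) unitVol := hφ.aemeasurable.inv
  refine ext_of_cdf ?_ ?_ ?_ ?_
  · have : Integrable (fun t => (φ t)⁻¹) (densMeasure φ) := by
      rw [hφ.integrable_densMeasure_iff]
      refine (integrable_const (1 : ℝ)).congr ?_
      filter_upwards [hφ.pos] with t ht
      rw [mul_inv_cancel₀ ht.ne']
    rw [← h.map_warpInv] at this
    exact this.comp_aemeasurable h.aemeasurable_warpInv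
  · have := IsPosDensity.densMeasure_ac (g := φ) |>.ae_le hφ.pos
    rw [← h.map_warpInv] at this
    filter_upwards [ae_of_ae_map h.aemeasurable_warpInv this] with u hu
    exact inv_pos.2 hu
  · have : Φ 1 = 1 := h.map_one
    conv_lhs => rw [← this]
    exact h.invOn.1 (by simp)
  · intro u hu
    set t := _root_.warpInv Φ u with htdef
    have ht : t ∈ Icc (0 : ℝ) 1 := h.bijOn_warpInv.mapsTo hu
    have h1 : (Iic u).indicator (fun u => (φ (_root_.warpInv Φ u))⁻¹) =ᵐ[unitVol]
        fun u => (Iic t).indicator (fun t => (φ t)⁻¹) (_root_.warpInv Φ u) := by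
      filter_upwards [ae_mem_unit] with v hv
      have : v ∈ Iic u ↔ _root_.warpInv Φ v ∈ Iic t :=
        (h.strictMonoOn_warpInv.le_iff_le hv hu).symm
      by_cases hvu : v ∈ Iic u
      · rw [indicator_of_mem hvu, indicator_of_mem (this.1 hvu)]
      · rw [indicator_of_notMem hvu, indicator_of_notMem (fun h' => hvu (this.2 h'))]
    rw [integral_congr_ae h1, key _ (hinv.indicator measurableSet_Iic)]
    have h2 : (fun s => φ s * (Iic t).indicator (fun t => (φ t)⁻¹) s) =ᵐ[unitVol]
        (Iic t).indicator (fun _ => (1 : ℝ)) := by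
      filter_upwards [hφ.pos] with s hs
      by_cases hst : s ∈ Iic t
      · rw [indicator_of_mem hst, indicator_of_mem hst, mul_inv_cancel₀ hs.ne']
      · rw [indicator_of_notMem hst, indicator_of_notMem hst, mul_zero]
    rw [integral_congr_ae h2, ← cdfOf_eq_integral_indicator _ ht]
    simp [cdfOf]

/-- The composition of two distribution functions is a distribution function. -/
theorem comp {A a : ℝ → ℝ} (ha : HasDens A a) (h : HasDens Φ φ) :
    HasDens (A ∘ Φ) (fun t => a (Φ t) * φ t) := by
  have hcomm : (fun t => a (Φ t) * φ t) = fun t => φ t * a (Φ t) := by ext t; ring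
  refine ext_of_cdf ?_ ?_ ?_ ?_
  · rw [hcomm]; exact h.integrable_mul_comp ha.isPosDensity.integrable
  · filter_upwards [h.ae_comp ha.isPosDensity.pos, h.isPosDensity.pos] with t h1 h2
    exact mul_pos h1 h2
  · simp [h.map_one, ha.map_one]
  · intro t ht
    have hΦt := h.bijOn.mapsTo ht
    rw [Function.comp, ha.eqOn hΦt, cdfOf_eq_integral_indicator a hΦt,
      ← h.integral_mul_comp (ha.isPosDensity.aemeasurable.indicator measurableSet_Iic)]
    apply integral_congr_ae
    filter_upwards [ae_mem_unit] with s hs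
    have : s ∈ Iic t ↔ Φ s ∈ Iic (Φ t) := (h.strictMonoOn.le_iff_le hs ht).symm
    by_cases hst : s ∈ Iic t
    · rw [indicator_of_mem hst, indicator_of_mem (this.1 hst), mul_comm]
    · rw [indicator_of_notMem hst, indicator_of_notMem (fun h' => hst (this.2 h')), mul_zero]

/-- Lebesgue differentiation. This links the pointwise derivatives of the definitions to densities;
a null set is lost, which no integral notices. -/
theorem warpDeriv_ae (h : HasDens Φ φ) : warpDeriv Φ =ᵐ[unitVol] φ := by
  have h0 : (0 : ℝ) ∈ Icc (0 : ℝ) 1 := by simp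
  have h1 : (1 : ℝ) ∈ Icc (0 : ℝ) 1 := by simp
  have := (h.isPosDensity.intervalIntegrable h0 h1).ae_hasDerivAt_integral
  filter_upwards [ae_restrict_of_ae this, ae_mem_unit] with t ht htI
  have hd := ht (by rwa [uIcc_of_le zero_le_one]) 0 (by simp)
  rw [warpDeriv, derivWithin_congr (f := cdfOf φ) h.eqOn (h.eqOn htI)]
  exact hd.hasDerivWithinAt.derivWithin (uniqueDiffOn_Icc zero_lt_one t htI)

theorem unique {Φ' φ' : ℝ → ℝ} (h : HasDens Φ φ) (h' : HasDens Φ' φ')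
    (he : EqOn Φ Φ' (Icc 0 1)) : φ =ᵐ[unitVol] φ' :=
  h.warpDeriv_ae.symm.trans ((h'.congr he.symm).warpDeriv_ae)

end HasDens

theorem warpInv_eqOn_of_invOn {Φ Ψ φ : ℝ → ℝ} (h : HasDens Φ φ)
    (hm : MapsTo Ψ (Icc 0 1) (Icc 0 1)) (hinv : ∀ t ∈ Icc (0 : ℝ) 1, Φ (Ψ t) = t) :
    EqOn (warpInv Φ) Ψ (Icc 0 1) := by
  intro t ht
  conv_lhs => rw [← hinv t ht]
  exact h.invOn.1 (hm ht)

theorem warpInv_congr {Φ Ψ φ : ℝ → ℝ} (h : HasDens Φ φ) (he : EqOn Φ Ψ (Icc 0 1)) :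
    EqOn (warpInv Φ) (warpInv Ψ) (Icc 0 1) := by
  have h' := h.congr he
  refine warpInv_eqOn_of_invOn h h'.bijOn_warpInv.mapsTo fun t ht => ?_
  rw [he (h'.bijOn_warpInv.mapsTo ht), h'.invOn.2 ht]

theorem warpInv_comp {A a B b : ℝ → ℝ} (ha : HasDens A a) (hb : HasDens B b) :
    EqOn (warpInv (A ∘ B)) (warpInv B ∘ warpInv A) (Icc 0 1) :=
  warpInv_eqOn_of_invOn (ha.comp hb) (hb.bijOn_warpInv.mapsTo.comp ha.bijOn_warpInv.mapsTo)
    fun t ht => by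
      simp only [Function.comp]
      rw [hb.invOn.2 (ha.bijOn_warpInv.mapsTo ht), ha.invOn.2 ht]

theorem warpInv_warpInv {A a : ℝ → ℝ} (ha : HasDens A a) :
    EqOn (warpInv (warpInv A)) A (Icc 0 1) :=
  warpInv_eqOn_of_invOn ha.warpInv ha.bijOn.mapsTo fun _ ht => ha.invOn.1 ht

/-! ### Time warpings -/

namespace IsWarp

variable {γ : ℝ → ℝ}

theorem hasDerivWithinAt (hγ : IsWarp γ) {t : ℝ} (ht : t ∈ Icc (0 : ℝ) 1) :
    HasDerivWithinAt γ (warpDeriv γ t) (Icc 0 1) t := by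
  obtain ⟨d, -, hd⟩ := hγ.deriv_pos t ht
  exact hd.differentiableWithinAt.hasDerivWithinAt

theorem warpDeriv_pos (hγ : IsWarp γ) {t : ℝ} (ht : t ∈ Icc (0 : ℝ) 1) : 0 < warpDeriv γ t := by
  obtain ⟨d, hd0, hd⟩ := hγ.deriv_pos t ht
  rw [warpDeriv, hd.derivWithin (uniqueDiffOn_Icc zero_lt_one t ht)]
  exact hd0

theorem continuousOn (hγ : IsWarp γ) : ContinuousOn γ (Icc 0 1) := fun _ ht =>
  (hγ.hasDerivWithinAt ht).continuousWithinAt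

theorem hasDerivAt (hγ : IsWarp γ) {t : ℝ} (ht : t ∈ Ioo (0 : ℝ) 1) :
    HasDerivAt γ (warpDeriv γ t) t :=
  (hγ.hasDerivWithinAt (Ioo_subset_Icc_self ht)).hasDerivAt (Icc_mem_nhds ht.1 ht.2)

theorem hasDens (hγ : IsWarp γ) : HasDens γ (warpDeriv γ) := by
  -- The derivative is not assumed continuous or bounded; being nonnegative, it is integrable
  -- anyway, and the fundamental theorem of calculus applies.
  have hint : IntegrableOn (warpDeriv γ) (Ioc 0 1) :=
    intervalIntegral.integrableOn_deriv_of_nonneg hγ.continuousOn (fun t ht => hγ.hasDerivAt ht)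
      fun t ht => (hγ.warpDeriv_pos (Ioo_subset_Icc_self ht)).le
  have hint' : IntegrableOn (warpDeriv γ) (Icc 0 1) :=
    (integrableOn_Icc_iff_integrableOn_Ioc (by simp)).2 hint
  have key : ∀ t ∈ Icc (0 : ℝ) 1, cdfOf (warpDeriv γ) t = γ t := by
    intro t ht
    rw [cdfOf, intervalIntegral.integral_eq_sub_of_hasDerivAt_of_le ht.1
      (hγ.continuousOn.mono (Icc_subset_Icc_right ht.2))
      (fun x hx => hγ.hasDerivAt ⟨hx.1, hx.2.trans_le ht.2⟩), hγ.map_zero, sub_zero]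
    rw [intervalIntegrable_iff, uIoc_of_le ht.1]
    exact hint.mono_set (Ioc_subset_Ioc_right ht.2)
  refine HasDens.ext_of_cdf hint' ?_ hγ.map_one fun t ht => ?_
  · filter_upwards [ae_mem_unit] with t ht using hγ.warpDeriv_pos ht
  · rw [← cdfOf_eq_integral_indicator _ ht, key t ht]

end IsWarp

/-! ### The square root of the quantile density and the phase distance -/

theorem eLpNorm_two_eq (μ : Measure ℝ) (g : ℝ → ℝ) :
    eLpNorm g 2 μ = (∫⁻ t, ENNReal.ofReal (g t ^ 2) ∂μ) ^ (1 / 2 : ℝ) := by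
  rw [eLpNorm_eq_lintegral_rpow_enorm_toReal (by norm_num) (by norm_num)]
  congr 1
  apply lintegral_congr
  intro t
  simp only [ENNReal.toReal_ofNat]
  rw [← ofReal_norm, ENNReal.ofReal_rpow_of_nonneg (norm_nonneg _) (by norm_num)]
  congr 1
  norm_num

theorem l2Norm_eq_eLpNorm {g : ℝ → ℝ} (hg : AEMeasurable g unitVol) :
    l2Norm g = (eLpNorm g 2 unitVol).toReal := by
  rw [l2Norm, ← integral_unitVol fun t => g t ^ 2, eLpNorm_two_eq,
    integral_eq_lintegral_of_nonneg_ae (ae_of_all _ fun t => sq_nonneg _)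
      (hg.pow_const 2).aestronglyMeasurable, ← ENNReal.toReal_rpow, Real.sqrt_eq_rpow]

theorem l2Norm_congr_ae {g g' : ℝ → ℝ} (h : g =ᵐ[unitVol] g') : l2Norm g = l2Norm g' := by
  rw [l2Norm, l2Norm, ← integral_unitVol fun t => g t ^ 2, ← integral_unitVol fun t => g' t ^ 2]
  congr 1
  apply integral_congr_ae
  filter_upwards [h] with t ht
  rw [ht]

/-- The isometric right action of a distribution function `Φ` with density `φ` on `L²[0, 1]`. -/
def rootAct (Φ φ ψ : ℝ → ℝ) (t : ℝ) : ℝ := Real.sqrt (φ t) * ψ (Φ t)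

/-- The square root of the quantile density of `g`. -/
def rootQuant (g : ℝ → ℝ) (s : ℝ) : ℝ := Real.sqrt ((g (warpInv (cdfOf g) s))⁻¹)

open Classical in
/-- The square root of the quantile density as an element of `L²[0, 1]`. -/
def rootVec (g : ℝ → ℝ) : Lp ℝ 2 unitVol :=
  if h : MemLp (rootQuant g) 2 unitVol then h.toLp else 0

namespace HasDens

variable {Φ φ : ℝ → ℝ}

theorem aemeasurable_rootAct (h : HasDens Φ φ) {ψ : ℝ → ℝ} (hψ : AEMeasurable ψ unitVol) :
    AEMeasurable (rootAct Φ φ ψ) unitVol :=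
  (h.isPosDensity.aemeasurable.sqrt).mul (h.aemeasurable_comp hψ)

/-- The substitution `s = Φ t`, `ds = φ t dt`; the factor `√φ` in the action is what the square
needs. -/
theorem eLpNorm_rootAct (h : HasDens Φ φ) {ψ : ℝ → ℝ} (hψ : AEMeasurable ψ unitVol) :
    eLpNorm (rootAct Φ φ ψ) 2 unitVol = eLpNorm ψ 2 unitVol := by
  have hΦ : AEMeasurable Φ (densMeasure φ) :=
    h.aemeasurable.mono_ac IsPosDensity.densMeasure_ac
  rw [eLpNorm_two_eq, eLpNorm_two_eq]
  congr 1
  have h1 : ∫⁻ s, ENNReal.ofReal (ψ s ^ 2) ∂unitVol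
      = ∫⁻ s, ENNReal.ofReal (ψ s ^ 2) ∂((densMeasure φ).map Φ) := by rw [h.map_densMeasure]
  have h2 : AEMeasurable (fun t => ENNReal.ofReal (ψ (Φ t) ^ 2)) unitVol :=
    ((h.aemeasurable_comp hψ).pow_const 2).ennreal_ofReal
  rw [h1, lintegral_map' (by rw [h.map_densMeasure]; exact (hψ.pow_const 2).ennreal_ofReal) hΦ,
    densMeasure, lintegral_withDensity_eq_lintegral_mul₀
      h.isPosDensity.aemeasurable.ennreal_ofReal h2]
  apply lintegral_congr_ae
  filter_upwards [h.isPosDensity.pos] with t ht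
  rw [rootAct, mul_pow, Real.sq_sqrt ht.le, ENNReal.ofReal_mul ht.le, Pi.mul_apply]

end HasDens

namespace IsPosDensity

variable {g : ℝ → ℝ}

theorem aemeasurable_rootQuant (hg : IsPosDensity g) : AEMeasurable (rootQuant g) unitVol :=
  hg.hasDens.warpInv.isPosDensity.aemeasurable.sqrt

theorem rootQuant_pos (hg : IsPosDensity g) : ∀ᵐ s ∂unitVol, 0 < rootQuant g s := by
  filter_upwards [hg.hasDens.warpInv.isPosDensity.pos] with s hs using Real.sqrt_pos.2 hs

/-- The quantile density at `G t` is `1 / g t`. So every root lies in the orbit of the constant `1`,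
and has norm one. -/
theorem rootAct_rootQuant (hg : IsPosDensity g) :
    rootAct (cdfOf g) g (rootQuant g) =ᵐ[unitVol] fun _ => 1 := by
  filter_upwards [hg.pos, ae_mem_unit] with t ht htI
  rw [rootAct, rootQuant, hg.hasDens.invOn.1 htI, ← Real.sqrt_mul ht.le, mul_inv_cancel₀ ht.ne',
    Real.sqrt_one]

theorem eLpNorm_rootQuant (hg : IsPosDensity g) : eLpNorm (rootQuant g) 2 unitVol = 1 := by
  rw [← hg.hasDens.eLpNorm_rootAct hg.aemeasurable_rootQuant,
    eLpNorm_congr_ae hg.rootAct_rootQuant, eLpNorm_const' _ (by norm_num) (by norm_num)]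
  simp

theorem memLp_rootQuant (hg : IsPosDensity g) : MemLp (rootQuant g) 2 unitVol :=
  ⟨hg.aemeasurable_rootQuant.aestronglyMeasurable, by simp [hg.eLpNorm_rootQuant]⟩

theorem rootVec_eq (hg : IsPosDensity g) : rootVec g = hg.memLp_rootQuant.toLp := by
  rw [rootVec, dif_pos hg.memLp_rootQuant]

theorem coeFn_rootVec (hg : IsPosDensity g) : rootVec g =ᵐ[unitVol] rootQuant g := by
  rw [hg.rootVec_eq]; exact MemLp.coeFn_toLp _

theorem norm_rootVec (hg : IsPosDensity g) : ‖rootVec g‖ = 1 := by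
  rw [hg.rootVec_eq, Lp.norm_toLp, hg.eLpNorm_rootQuant, ENNReal.toReal_one]

theorem hasDens_optWarp {ν : ℝ → ℝ} (hν : IsPosDensity ν) (hg : IsPosDensity g) :
    HasDens (optWarp ν g) fun t => (g (warpInv (cdfOf g) (cdfOf ν t)))⁻¹ * ν t :=
  hg.hasDens.warpInv.comp hν.hasDens

theorem srvf_optWarp {ν : ℝ → ℝ} (hν : IsPosDensity ν) (hg : IsPosDensity g) :
    srvf (optWarp ν g) =ᵐ[unitVol] rootAct (cdfOf ν) ν (rootQuant g) := by
  filter_upwards [(hν.hasDens_optWarp hg).warpDeriv_ae, hν.pos] with t ht h0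
  rw [srvf, ht, mul_comm, Real.sqrt_mul h0.le, rootAct, rootQuant]

/-- The functions `1` and `√γ̇*` are the images of the two roots under one and the same linear
isometry, the action of the distribution function of `ν`. -/
theorem dExt_eq_norm {ν : ℝ → ℝ} (hν : IsPosDensity ν) (hg : IsPosDensity g) :
    dExt ν g = ‖rootVec ν - rootVec g‖ := by
  have h1 : (fun t => 1 - srvf (optWarp ν g) t) =ᵐ[unitVol]
      rootAct (cdfOf ν) ν (fun s => rootQuant ν s - rootQuant g s) := by
    filter_upwards [hν.srvf_optWarp hg, hν.rootAct_rootQuant] with t h2 h3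
    rw [h2, ← h3]
    simp only [rootAct]; ring
  have hm : AEMeasurable (fun s => rootQuant ν s - rootQuant g s) unitVol :=
    hν.aemeasurable_rootQuant.sub hg.aemeasurable_rootQuant
  rw [dExt, l2Norm_congr_ae h1, l2Norm_eq_eLpNorm (hν.hasDens.aemeasurable_rootAct hm),
    hν.hasDens.eLpNorm_rootAct hm, hν.rootVec_eq, hg.rootVec_eq, ← MemLp.toLp_sub, Lp.norm_toLp]
  rfl

end IsPosDensity

/-! ### The output of the Karcher mean algorithm -/

section Karcher

variable {n : ℕ} {g : Fin n → ℝ → ℝ}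

theorem memLp_sum_rootQuant (hg : ∀ i, IsPosDensity (g i)) :
    MemLp (fun s => ∑ i, rootQuant (g i) s) 2 unitVol :=
  memLp_finsetSum _ fun i _ => (hg i).memLp_rootQuant

theorem coeFn_sum_rootVec (hg : ∀ i, IsPosDensity (g i)) :
    ⇑(∑ i, rootVec (g i)) =ᵐ[unitVol] fun s => ∑ i, rootQuant (g i) s := by
  have h1 : ∀ᵐ s ∂unitVol, ∀ i, rootVec (g i) s = rootQuant (g i) s :=
    ae_all_iff.2 fun i => (hg i).coeFn_rootVec
  filter_upwards [h1, Lp.coeFn_fun_finsetSum Finset.univ fun i => rootVec (g i)] with s h2 h3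
  rw [h3]
  exact Finset.sum_congr rfl fun i _ => h2 i

theorem norm_sum_rootVec (hg : ∀ i, IsPosDensity (g i)) :
    ‖∑ i, rootVec (g i)‖ = (eLpNorm (fun s => ∑ i, rootQuant (g i) s) 2 unitVol).toReal := by
  rw [Lp.norm_def, eLpNorm_congr_ae (coeFn_sum_rootVec hg)]

theorem sum_rootQuant_pos (hg : ∀ i, IsPosDensity (g i)) (j₀ : Fin n) :
    ∀ᵐ s ∂unitVol, 0 < ∑ i, rootQuant (g i) s := by
  filter_upwards [ae_all_iff.2 fun i => (hg i).rootQuant_pos] with s hs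
  exact Finset.sum_pos (fun i _ => hs i) ⟨j₀, Finset.mem_univ _⟩

theorem norm_sum_rootVec_pos (hg : ∀ i, IsPosDensity (g i)) (j₀ : Fin n) :
    0 < ‖∑ i, rootVec (g i)‖ := by
  rw [norm_pos_iff]
  intro h0
  have h1 := coeFn_sum_rootVec hg
  rw [h0] at h1
  have : ∀ᵐ _ ∂unitVol, False := by
    filter_upwards [h1, Lp.coeFn_zero ℝ 2 unitVol, sum_rootQuant_pos hg j₀] with s a b c
    rw [← a, b] at c
    exact lt_irrefl _ c
  exact this.exists.elim fun _ h => h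

/-- The inverse of the optimal warping from `g i` to `g j₀` is the one from `g j₀` to `g i`. All
summands are thus roots moved by a common isometry, and `j₀` enters only through it. -/
theorem karcherSum_ae (hg : ∀ i, IsPosDensity (g i)) (j₀ : Fin n) :
    karcherSum g j₀ =ᵐ[unitVol]
      rootAct (cdfOf (g j₀)) (g j₀) (fun s => ∑ i, rootQuant (g i) s) := by
  have h1 : ∀ i, srvf (warpInv (optWarp (g i) (g j₀))) =ᵐ[unitVol]
      rootAct (cdfOf (g j₀)) (g j₀) (rootQuant (g i)) := by
    intro i
    have he : EqOn (warpInv (optWarp (g i) (g j₀))) (optWarp (g j₀) (g i)) (Icc 0 1) := by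
      intro t ht
      have h2 := warpInv_comp (hg j₀).hasDens.warpInv (hg i).hasDens ht
      rw [optWarp, h2, Function.comp, warpInv_warpInv (hg j₀).hasDens ht]
      rfl
    have hd := ((hg j₀).hasDens_optWarp (hg i)).congr he.symm
    filter_upwards [hd.warpDeriv_ae, (hg j₀).srvf_optWarp (hg i),
      ((hg j₀).hasDens_optWarp (hg i)).warpDeriv_ae] with t a b c
    rw [← b, srvf, srvf, a, c]
  filter_upwards [ae_all_iff.2 h1] with t ht
  simp only [karcherSum, rootAct, Finset.mul_sum]
  exact Finset.sum_congr rfl fun i _ => ht i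

theorem l2Norm_karcherSum (hg : ∀ i, IsPosDensity (g i)) (j₀ : Fin n) :
    l2Norm (karcherSum g j₀) = ‖∑ i, rootVec (g i)‖ := by
  have hm : AEMeasurable (fun s => ∑ i, rootQuant (g i) s) unitVol :=
    (memLp_sum_rootQuant hg).1.aemeasurable
  rw [l2Norm_congr_ae (karcherSum_ae hg j₀),
    l2Norm_eq_eLpNorm ((hg j₀).hasDens.aemeasurable_rootAct hm),
    (hg j₀).hasDens.eLpNorm_rootAct hm, norm_sum_rootVec hg]

/-- The quantile density of the Karcher mean. -/
def meanQuantDens (g : Fin n → ℝ → ℝ) (s : ℝ) : ℝ :=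
  ((∑ i, rootQuant (g i) s) / ‖∑ i, rootVec (g i)‖) ^ 2

theorem isPosDensity_meanQuantDens (hg : ∀ i, IsPosDensity (g i)) (j₀ : Fin n) :
    IsPosDensity (meanQuantDens g) := by
  have hc := norm_sum_rootVec_pos hg j₀
  have hQ := memLp_sum_rootQuant hg
  have heq : meanQuantDens g = fun s =>
      (‖∑ i, rootVec (g i)‖ ^ 2)⁻¹ * (∑ i, rootQuant (g i) s) ^ 2 := by
    ext s; rw [meanQuantDens, div_pow, div_eq_inv_mul]
  refine ⟨?_, ?_, ?_⟩
  · rw [heq]; exact hQ.integrable_sq.const_mul _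
  · filter_upwards [sum_rootQuant_pos hg j₀] with s hs
    exact pow_pos (div_pos hs hc) 2
  · rw [heq, intervalIntegral.integral_const_mul]
    have h1 : l2Norm (fun s => ∑ i, rootQuant (g i) s) = ‖∑ i, rootVec (g i)‖ := by
      rw [l2Norm_eq_eLpNorm hQ.1.aemeasurable, norm_sum_rootVec hg]
    have h2 : 0 ≤ ∫ t in (0 : ℝ)..1, (∑ i, rootQuant (g i) t) ^ 2 :=
      intervalIntegral.integral_nonneg zero_le_one fun t _ => sq_nonneg _
    rw [← h1, l2Norm, Real.sq_sqrt h2]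
    apply inv_mul_cancel₀
    intro h0
    rw [← h1, l2Norm, h0] at hc
    simp at hc

theorem hasDens_karcherWarp (hg : ∀ i, IsPosDensity (g i)) (j₀ : Fin n) :
    HasDens (karcherWarp g j₀) fun t => meanQuantDens g (cdfOf (g j₀) t) * g j₀ t := by
  have hd := (isPosDensity_meanQuantDens hg j₀).hasDens.comp (hg j₀).hasDens
  refine ⟨hd.isPosDensity, ?_⟩
  have : (fun s => (karcherSum g j₀ s / l2Norm (karcherSum g j₀)) ^ 2) =ᵐ[unitVol]
      fun t => meanQuantDens g (cdfOf (g j₀) t) * g j₀ t := by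
    filter_upwards [karcherSum_ae hg j₀, (hg j₀).pos] with t ht h0
    rw [ht, l2Norm_karcherSum hg, rootAct, meanQuantDens, div_pow, div_pow, mul_pow,
      Real.sq_sqrt h0.le]
    ring
  exact cdfOf_congr_ae this

theorem karcherWarp_eqOn (hg : ∀ i, IsPosDensity (g i)) (j₀ : Fin n) :
    EqOn (karcherWarp g j₀) (cdfOf (meanQuantDens g) ∘ cdfOf (g j₀)) (Icc 0 1) :=
  (hasDens_karcherWarp hg j₀).eqOn.trans
    ((isPosDensity_meanQuantDens hg j₀).hasDens.comp (hg j₀).hasDens).eqOn.symm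

theorem hasDens_karcherAlg (hg : ∀ i, IsPosDensity (g i)) (j₀ : Fin n) :
    HasDens (cdfOf (g j₀) ∘ warpInv (karcherWarp g j₀)) (karcherAlg g j₀) := by
  have hw := (hasDens_karcherWarp hg j₀).warpInv
  refine ((hg j₀).hasDens.comp hw).congr_ae ?_
  filter_upwards [hw.warpDeriv_ae] with t ht
  rw [karcherAlg, areaAct, ht]

/-- With `M` the distribution function of `meanQuantDens g`, the warping is `γ̄ = M ∘ G_{j₀}`. The
output has distribution function `G_{j₀} ∘ γ̄⁻¹ = M⁻¹`, so `j₀` cancels and `M` is the quantile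
function of the output. -/
theorem rootVec_karcherAlg (hg : ∀ i, IsPosDensity (g i)) (j₀ : Fin n) :
    rootVec (karcherAlg g j₀) = ‖∑ i, rootVec (g i)‖⁻¹ • ∑ i, rootVec (g i) := by
  have hout := hasDens_karcherAlg hg j₀
  have hkw := hasDens_karcherWarp hg j₀
  have hw := (isPosDensity_meanQuantDens hg j₀).hasDens
  have he : EqOn (warpInv (cdfOf (karcherAlg g j₀))) (cdfOf (meanQuantDens g)) (Icc 0 1) := by
    intro t ht
    have h0 := (hg j₀).hasDens.bijOn_warpInv.mapsTo ht
    rw [← warpInv_congr hout hout.eqOn ht, warpInv_comp (hg j₀).hasDens hkw.warpInv ht,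
      Function.comp, warpInv_warpInv hkw h0, karcherWarp_eqOn hg j₀ h0, Function.comp,
      (hg j₀).hasDens.invOn.2 ht]
  have hq := hout.isPosDensity.hasDens.warpInv.unique hw he
  have hc := norm_sum_rootVec_pos hg j₀
  apply Lp.ext
  filter_upwards [hq, hout.isPosDensity.coeFn_rootVec, coeFn_sum_rootVec hg,
    sum_rootQuant_pos hg j₀, Lp.coeFn_smul (‖∑ i, rootVec (g i)‖⁻¹) (∑ i, rootVec (g i))]
    with s h1 h2 h3 h4 h5
  rw [h2, h5, Pi.smul_apply, h3, rootQuant, h1, meanQuantDens, Real.sqrt_sq (div_pos h4 hc).le,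
    smul_eq_mul, div_eq_inv_mul]

theorem isKarcherMean_karcherAlg (hg : ∀ i, IsPosDensity (g i)) (j₀ : Fin n) :
    IsKarcherMean g (karcherAlg g j₀) := by
  have hout := (hasDens_karcherAlg hg j₀).isPosDensity
  refine ⟨hout, fun ν hν => ?_⟩
  have hc := norm_sum_rootVec_pos hg j₀
  -- All roots are unit vectors, so minimizing the squared distances means maximizing an inner
  -- product with a fixed vector; Cauchy–Schwarz finishes.
  have key : ∀ μ : ℝ → ℝ, IsPosDensity μ → ∑ i, dExt μ (g i) ^ 2
      = 2 * n - 2 * inner ℝ (rootVec μ) (∑ i, rootVec (g i)) := by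
    intro μ hμ
    rw [inner_sum, Finset.mul_sum]
    have : (2 * n : ℝ) = ∑ _i : Fin n, (2 : ℝ) := by simp; ring
    rw [this, ← Finset.sum_sub_distrib]
    refine Finset.sum_congr rfl fun i _ => ?_
    rw [hμ.dExt_eq_norm (hg i), norm_sub_sq_real, hμ.norm_rootVec, (hg i).norm_rootVec]
    ring
  rw [key _ hout, key _ hν, rootVec_karcherAlg hg j₀, real_inner_smul_left,
    real_inner_self_eq_norm_sq]
  have h1 := real_inner_le_norm (rootVec ν) (∑ i, rootVec (g i))
  rw [hν.norm_rootVec, one_mul] at h1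
  have h2 : ‖∑ i, rootVec (g i)‖⁻¹ * ‖∑ i, rootVec (g i)‖ ^ 2 = ‖∑ i, rootVec (g i)‖ := by
    field_simp
  rw [h2]
  linarith

end Karcher

/-! ### Continuity of the square root of the quantile density -/

namespace IsPosDensity

variable {g g' : ℝ → ℝ}

theorem abs_cdfOf_sub_le (hg : IsPosDensity g) (hg' : IsPosDensity g') {t : ℝ}
    (ht : t ∈ Icc (0 : ℝ) 1) : |cdfOf g' t - cdfOf g t| ≤ ∫ s, |g' s - g s| ∂unitVol := by
  rw [cdfOf_eq_integral_indicator _ ht, cdfOf_eq_integral_indicator _ ht,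
    ← integral_sub (hg'.integrable.indicator measurableSet_Iic)
      (hg.integrable.indicator measurableSet_Iic)]
  refine (abs_integral_le_integral_abs).trans ?_
  apply integral_mono_of_nonneg (ae_of_all _ fun s => abs_nonneg _)
    ((hg'.integrable.sub hg.integrable).abs)
  refine ae_of_all _ fun s => ?_
  by_cases hs : s ∈ Iic t
  · simp [indicator_of_mem hs]
  · simp [indicator_of_notMem hs]

/-- Continuity of the action in the acting density, for bounded `ψ` with modulus of continuity `η`
at scale `δ`. The roots of the densities satisfy `(√g' - √g)² ≤ |g' - g|`, and the distribution
functions differ uniformly by at most the `L¹` distance. -/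
theorem eLpNorm_rootAct_sub_le (hg : IsPosDensity g) (hg' : IsPosDensity g') {ψ : ℝ → ℝ}
    {B η δ : ℝ} (hB : ∀ x, |ψ x| ≤ B)
    (hη : ∀ x y, |x - y| < δ → |ψ x - ψ y| ≤ η) (hδ : ∫ s, |g' s - g s| ∂unitVol < δ) :
    eLpNorm (fun t => rootAct (cdfOf g') g' ψ t - rootAct (cdfOf g) g ψ t) 2 unitVol
      ≤ ENNReal.ofReal
        (Real.sqrt (2 * B ^ 2 * (∫ s, |g' s - g s| ∂unitVol) + 2 * η ^ 2)) := by
  have hi1 : Integrable (fun s => 2 * B ^ 2 * |g' s - g s|) unitVol :=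
    (hg'.integrable.sub hg.integrable).abs.const_mul _
  have hi2 : Integrable (fun s => 2 * η ^ 2 * g s) unitVol := hg.integrable.const_mul _
  have hint : ∫ s, (2 * B ^ 2 * |g' s - g s| + 2 * η ^ 2 * g s) ∂unitVol
      = 2 * B ^ 2 * (∫ s, |g' s - g s| ∂unitVol) + 2 * η ^ 2 := by
    rw [integral_add hi1 hi2, integral_const_mul, integral_const_mul, integral_unitVol g,
      hg.integral_eq_one, mul_one]
  have hnn : 0 ≤ᵐ[unitVol] fun s => 2 * B ^ 2 * |g' s - g s| + 2 * η ^ 2 * g s := by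
    filter_upwards [hg.pos] with s hs
    have := abs_nonneg (g' s - g s)
    simp only [Pi.zero_apply]
    positivity
  have hnn' : 0 ≤ 2 * B ^ 2 * (∫ s, |g' s - g s| ∂unitVol) + 2 * η ^ 2 := by
    rw [← hint]; exact integral_nonneg_of_ae hnn
  rw [eLpNorm_two_eq, Real.sqrt_eq_rpow, ← ENNReal.ofReal_rpow_of_nonneg hnn' (by norm_num)]
  apply ENNReal.rpow_le_rpow _ (by norm_num)
  rw [← hint, ofReal_integral_eq_lintegral_ofReal (hi1.fun_add hi2) hnn]
  apply lintegral_mono_ae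
  filter_upwards [hg.pos, hg'.pos, ae_mem_unit] with t h1 h2 ht
  apply ENNReal.ofReal_le_ofReal
  simp only [rootAct]
  set a := Real.sqrt (g t)
  set b := Real.sqrt (g' t)
  have ha : a ^ 2 = g t := Real.sq_sqrt h1.le
  have hb : b ^ 2 = g' t := Real.sq_sqrt h2.le
  have ha0 : 0 ≤ a := Real.sqrt_nonneg _
  have hb0 : 0 ≤ b := Real.sqrt_nonneg _
  have h3 : (b - a) ^ 2 ≤ |g' t - g t| := by
    rw [← ha, ← hb, show b ^ 2 - a ^ 2 = (b - a) * (b + a) by ring, abs_mul, ← sq_abs, sq]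
    apply mul_le_mul_of_nonneg_left _ (abs_nonneg _)
    rw [abs_le, abs_of_nonneg (by positivity : 0 ≤ b + a)]
    constructor <;> linarith
  have h4 : |ψ (cdfOf g' t) - ψ (cdfOf g t)| ≤ η :=
    hη _ _ ((hg.abs_cdfOf_sub_le hg' ht).trans_lt hδ)
  have h5 : (ψ (cdfOf g' t) - ψ (cdfOf g t)) ^ 2 ≤ η ^ 2 := by
    rw [← sq_abs]; exact pow_le_pow_left₀ (abs_nonneg _) h4 2
  have h6 : ψ (cdfOf g' t) ^ 2 ≤ B ^ 2 := by
    rw [← sq_abs]; exact pow_le_pow_left₀ (abs_nonneg _) (hB _) 2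
  set x := ψ (cdfOf g' t)
  set y := ψ (cdfOf g t)
  calc (b * x - a * y) ^ 2 = ((b - a) * x + a * (x - y)) ^ 2 := by ring
    _ ≤ 2 * ((b - a) * x) ^ 2 + 2 * (a * (x - y)) ^ 2 := by
      nlinarith [sq_nonneg ((b - a) * x - a * (x - y))]
    _ = 2 * ((b - a) ^ 2 * x ^ 2) + 2 * ((x - y) ^ 2 * g t) := by rw [← ha]; ring
    _ ≤ 2 * (|g' t - g t| * B ^ 2) + 2 * (η ^ 2 * g t) := by gcongr
    _ = _ := by ring

/-- Write `A`, `A'` for the actions of `g`, `g'` and `q`, `q'` for their roots. As `A q = 1 = A'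
q'`, one has `A' (q' - q) = A q - A' q`, which involves only the fixed root `q`. Replacing `q` by
`ψ` costs two isometric errors. -/
theorem norm_rootVec_sub_le (hg : IsPosDensity g) (hg' : IsPosDensity g') {ψ : ℝ → ℝ}
    (hψ : AEMeasurable ψ unitVol) :
    ENNReal.ofReal ‖rootVec g' - rootVec g‖ ≤
      eLpNorm (rootQuant g - ψ) 2 unitVol + eLpNorm (rootQuant g - ψ) 2 unitVol +
      eLpNorm (fun t => rootAct (cdfOf g') g' ψ t - rootAct (cdfOf g) g ψ t) 2 unitVol := by
  have hq := hg.aemeasurable_rootQuant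
  have hq' := hg'.aemeasurable_rootQuant
  have e1 : ENNReal.ofReal ‖rootVec g' - rootVec g‖ =
      eLpNorm (rootQuant g' - rootQuant g) 2 unitVol := by
    rw [hg.rootVec_eq, hg'.rootVec_eq, ← MemLp.toLp_sub, Lp.norm_toLp, ENNReal.ofReal_toReal]
    exact (hg'.memLp_rootQuant.sub hg.memLp_rootQuant).2.ne
  have e2 : rootAct (cdfOf g') g' (rootQuant g' - rootQuant g) =ᵐ[unitVol]
      (rootAct (cdfOf g) g (rootQuant g - ψ) - rootAct (cdfOf g') g' (rootQuant g - ψ))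
        - fun t => rootAct (cdfOf g') g' ψ t - rootAct (cdfOf g) g ψ t := by
    filter_upwards [hg.rootAct_rootQuant, hg'.rootAct_rootQuant] with t h1 h2
    simp only [rootAct, Pi.sub_apply] at h1 h2 ⊢
    linear_combination h2 - h1
  have m1 := hg.hasDens.aemeasurable_rootAct (hq.sub hψ)
  have m2 := hg'.hasDens.aemeasurable_rootAct (hq.sub hψ)
  have m3 := hg.hasDens.aemeasurable_rootAct hψ
  have m4 := hg'.hasDens.aemeasurable_rootAct hψ
  rw [e1, ← hg'.hasDens.eLpNorm_rootAct (hq'.sub hq), eLpNorm_congr_ae e2]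
  refine (eLpNorm_sub_le (m1.sub m2).aestronglyMeasurable (m4.sub m3).aestronglyMeasurable
    (by norm_num)).trans ?_
  gcongr
  · refine (eLpNorm_sub_le m1.aestronglyMeasurable m2.aestronglyMeasurable (by norm_num)).trans ?_
    rw [hg.hasDens.eLpNorm_rootAct (hq.sub hψ), hg'.hasDens.eLpNorm_rootAct (hq.sub hψ)]
  · exact le_rfl

/-- `L¹` convergence of densities implies `L²` convergence of the roots of their quantile
densities. -/
theorem tendsto_rootVec {ι : Type*} {l : Filter ι} {G : ι → ℝ → ℝ} (hg : IsPosDensity g)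
    (hG : ∀ᶠ m in l, IsPosDensity (G m))
    (hlim : Tendsto (fun m => ∫ t, |G m t - g t| ∂unitVol) l (𝓝 0)) :
    Tendsto (fun m => rootVec (G m)) l (𝓝 (rootVec g)) := by
  rw [Metric.tendsto_nhds]
  intro ε hε
  obtain ⟨ψ, hsupp, hψε, hψc, -⟩ :=
    hg.memLp_rootQuant.exists_hasCompactSupport_eLpNorm_sub_le (by norm_num)
      (ε := ENNReal.ofReal (ε / 8)) (by simpa using hε)
  obtain ⟨B, hB⟩ := hsupp.exists_bound_of_continuous hψc
  have huc := Metric.uniformContinuous_iff.1 (hsupp.uniformContinuous_of_continuous hψc)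
  obtain ⟨δ, hδ, hδψ⟩ := huc (ε / 4) (by positivity)
  -- Below `ε² / 8` this term gives `ε² / 8 + 2 (ε / 4)² = (ε / 2)²` under the root; the total is
  -- then `ε / 8 + ε / 8 + ε / 2 < ε`.
  have hlim2 : Tendsto (fun m => 2 * B ^ 2 * ∫ t, |G m t - g t| ∂unitVol) l (𝓝 0) := by
    simpa using hlim.const_mul (2 * B ^ 2)
  filter_upwards [hG, hlim.eventually (gt_mem_nhds hδ),
    hlim2.eventually (gt_mem_nhds (by positivity : 0 < ε ^ 2 / 8))] with m hm h1 h2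
  have h3 := hg.norm_rootVec_sub_le hm hψc.aemeasurable
  have h4 := hg.eLpNorm_rootAct_sub_le hm (ψ := ψ) (B := B) (η := ε / 4) (δ := δ) hB
    (fun x y hxy => (hδψ hxy).le) h1
  have h5 : Real.sqrt (2 * B ^ 2 * (∫ s, |G m s - g s| ∂unitVol) + 2 * (ε / 4) ^ 2) ≤ ε / 2 := by
    apply Real.sqrt_le_iff.2 ⟨by positivity, ?_⟩
    nlinarith
  have h6 : ENNReal.ofReal ‖rootVec (G m) - rootVec g‖ ≤
      ENNReal.ofReal (ε / 8 + ε / 8 + ε / 2) := by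
    rw [ENNReal.ofReal_add (by positivity) (by positivity),
      ENNReal.ofReal_add (by positivity) (by positivity)]
    refine h3.trans ?_
    gcongr
    exact h4.trans (ENNReal.ofReal_le_ofReal h5)
  rw [dist_eq_norm]
  have := (ENNReal.ofReal_le_ofReal_iff (by positivity)).1 h6
  linarith

end IsPosDensity

/-! ### `L¹` consistency of kernel estimates: deterministic part -/

/-- Continuity of translation in `L¹`. -/
theorem exists_lintegral_translate_le {F : ℝ → ℝ} (hF : Integrable F) {ε : ℝ} (hε : 0 < ε) :
    ∃ δ > 0, ∀ s : ℝ, |s| ≤ δ → ∫⁻ t, ‖F (t - s) - F t‖ₑ ≤ ENNReal.ofReal ε := by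
  obtain ⟨ψ, hsupp, hψε, hψc, hψi⟩ :=
    hF.exists_hasCompactSupport_integral_sub_le (by positivity : 0 < ε / 4)
  obtain ⟨R, hR⟩ := hsupp.isCompact.isBounded.subset_closedBall 0
  have hR0 : 0 ≤ max R 0 := le_max_right _ _
  set R' := max R 0
  have hψ0 : ∀ t, R' < |t| → ψ t = 0 := by
    intro t ht
    by_contra h
    have := hR (subset_tsupport _ h)
    rw [Metric.mem_closedBall, dist_zero_right, Real.norm_eq_abs] at this
    exact absurd (this.trans (le_max_left _ _)) (not_le.2 ht)
  -- A shift by at most `1` keeps `ψ (· - s) - ψ` supported in `[-(R' + 1), R' + 1]`; this modulus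
  -- times the length `2 (R' + 1)` is `ε / 2`.
  obtain ⟨δ, hδ, hδψ⟩ := Metric.uniformContinuous_iff.1
    (hsupp.uniformContinuous_of_continuous hψc) (ε / (4 * (R' + 1))) (by positivity)
  refine ⟨min (δ / 2) 1, by positivity, fun s hs => ?_⟩
  have hs1 : |s| < δ := (hs.trans (min_le_left _ _)).trans_lt (by linarith)
  have hs2 : |s| ≤ 1 := hs.trans (min_le_right _ _)
  have h1 : ∫⁻ t, ‖F t - ψ t‖ₑ ≤ ENNReal.ofReal (ε / 4) := by
    rw [← ofReal_integral_norm_eq_lintegral_enorm (f := fun t => F t - ψ t) (hF.sub hψi)]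
    exact ENNReal.ofReal_le_ofReal hψε
  have h2 : ∫⁻ t, ‖F (t - s) - ψ (t - s)‖ₑ = ∫⁻ t, ‖F t - ψ t‖ₑ :=
    lintegral_sub_right_eq_self (fun t => ‖F t - ψ t‖ₑ) s
  have h3 : ∫⁻ t, ‖ψ (t - s) - ψ t‖ₑ ≤ ENNReal.ofReal (ε / 2) := by
    calc ∫⁻ t, ‖ψ (t - s) - ψ t‖ₑ
        ≤ ∫⁻ t, (Icc (-(R' + 1)) (R' + 1)).indicator
            (fun _ => ENNReal.ofReal (ε / (4 * (R' + 1)))) t := by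
          apply lintegral_mono
          intro t
          by_cases ht : t ∈ Icc (-(R' + 1)) (R' + 1)
          · simp only [indicator_of_mem ht]
            rw [← ofReal_norm]
            apply ENNReal.ofReal_le_ofReal
            have := hδψ (a := t - s) (b := t) (by rw [Real.dist_eq]; simpa using hs1)
            rw [dist_eq_norm] at this
            exact this.le
          · have ht' : R' + 1 < |t| := by
              by_contra h
              exact ht (abs_le.1 (not_lt.1 h))
            have hts : R' < |t - s| := by
              have := abs_sub_abs_le_abs_sub t s
              linarith
            simp [hψ0 t (by linarith), hψ0 _ hts]
      _ = ENNReal.ofReal (ε / (4 * (R' + 1))) * ENNReal.ofReal (2 * (R' + 1)) := by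
          rw [lintegral_indicator measurableSet_Icc, setLIntegral_const, Real.volume_Icc]
          congr 2; ring
      _ = ENNReal.ofReal (ε / 2) := by
          rw [← ENNReal.ofReal_mul (by positivity)]
          congr 1; field_simp; ring
  have hm1 : AEMeasurable (fun t => ‖F (t - s) - ψ (t - s)‖ₑ) :=
    ((hF.comp_sub_right s).sub (hψi.comp_sub_right s)).aestronglyMeasurable.enorm
  have hm2 : AEMeasurable (fun t => ‖ψ (t - s) - ψ t‖ₑ) :=
    ((hψi.comp_sub_right s).sub hψi).aestronglyMeasurable.enorm
  calc ∫⁻ t, ‖F (t - s) - F t‖ₑ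
      ≤ ∫⁻ t, (‖F (t - s) - ψ (t - s)‖ₑ + (‖ψ (t - s) - ψ t‖ₑ + ‖F t - ψ t‖ₑ)) := by
        apply lintegral_mono
        intro t
        have : F (t - s) - F t = (F (t - s) - ψ (t - s)) + ((ψ (t - s) - ψ t) - (F t - ψ t)) := by
          ring
        simp only [this]
        exact (enorm_add_le _ _).trans (add_le_add_right (enorm_sub_le) _)
    _ = (∫⁻ t, ‖F t - ψ t‖ₑ) + ((∫⁻ t, ‖ψ (t - s) - ψ t‖ₑ) + ∫⁻ t, ‖F t - ψ t‖ₑ) := by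
        rw [lintegral_add_left' hm1, lintegral_add_left' hm2, h2]
    _ ≤ ENNReal.ofReal (ε / 4) + (ENNReal.ofReal (ε / 2) + ENNReal.ofReal (ε / 4)) := by gcongr
    _ = ENNReal.ofReal ε := by
        rw [← ENNReal.ofReal_add (by positivity) (by positivity),
          ← ENNReal.ofReal_add (by positivity) (by positivity)]
        congr 1; ring

theorem integrable_prod_translate {k : ℝ → ℝ} (hk : Integrable k) (hkm : Measurable k)
    (ν : Measure ℝ) [IsFiniteMeasure ν] {c : ℝ → ℝ} (hc : Measurable c) :
    Integrable (fun p : ℝ × ℝ => k (p.1 - c p.2)) (volume.prod ν) := by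
  have hm : Measurable (fun p : ℝ × ℝ => k (p.1 - c p.2)) :=
    hkm.comp (measurable_fst.sub (hc.comp measurable_snd))
  rw [integrable_prod_iff' hm.aestronglyMeasurable]
  refine ⟨ae_of_all _ fun y => hk.comp_sub_right (c y), ?_⟩
  have : (fun y => ∫ t, ‖k (t - c y)‖) = fun _ : ℝ => ∫ t, ‖k t‖ := by
    ext y
    exact integral_sub_right_eq_self (fun t => ‖k t‖) (c y)
  simp only [this]
  exact integrable_const _

/-- The effect of moving the points of `ν` on the convolution with `k`. -/
theorem lintegral_conv_sub_le {k : ℝ → ℝ} (hk : Integrable k) (hkm : Measurable k)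
    (ν : Measure ℝ) [IsProbabilityMeasure ν] {c : ℝ → ℝ} (hc : Measurable c) {ε : ENNReal}
    (hε : ∀ᵐ y ∂ν, ∫⁻ t, ‖k (t - y) - k (t - c y)‖ₑ ≤ ε) :
    ∫⁻ t, ‖∫ y, k (t - y) ∂ν - ∫ y, k (t - c y) ∂ν‖ₑ ≤ ε := by
  have h1 := integrable_prod_translate hk hkm ν measurable_id
  have h2 := integrable_prod_translate hk hkm ν hc
  have hm : Measurable (fun p : ℝ × ℝ => ‖k (p.1 - p.2) - k (p.1 - c p.2)‖ₑ) :=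
    ((hkm.comp (measurable_fst.sub measurable_snd)).sub
      (hkm.comp (measurable_fst.sub (hc.comp measurable_snd)))).enorm
  calc ∫⁻ t, ‖∫ y, k (t - y) ∂ν - ∫ y, k (t - c y) ∂ν‖ₑ
      ≤ ∫⁻ t, (∫⁻ y, ‖k (t - y) - k (t - c y)‖ₑ ∂ν) := by
        apply lintegral_mono_ae
        filter_upwards [h1.prod_right_ae, h2.prod_right_ae] with t a b
        simp only [id] at a
        rw [← integral_sub a b]
        exact enorm_integral_le_lintegral_enorm _
    _ = ∫⁻ y, (∫⁻ t, ‖k (t - y) - k (t - c y)‖ₑ) ∂ν := lintegral_lintegral_swap hm.aemeasurable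
    _ ≤ ∫⁻ _, ε ∂ν := lintegral_mono_ae hε
    _ = ε := by simp

/-- The cells of the partition of the line into intervals of length `a`. -/
def cell (a : ℝ) (j : ℕ) : Set ℝ := Ico (j * a) ((j + 1) * a)

/-- The `ℓ¹` distance on the cells of length `a` that meet `[0, 1]`. -/
def cellDev (a : ℝ) (ν μ : Measure ℝ) : ℝ :=
  ∑ j ∈ Finset.range (⌊1 / a⌋₊ + 1), |ν.real (cell a j) - μ.real (cell a j)|

theorem measurableSet_cell (a : ℝ) (j : ℕ) : MeasurableSet (cell a j) := measurableSet_Ico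

theorem mem_cell_iff {a : ℝ} (ha : 0 < a) {y : ℝ} (hy : 0 ≤ y) (j : ℕ) :
    y ∈ cell a j ↔ ⌊y / a⌋₊ = j := by
  rw [Nat.floor_eq_iff (by positivity), cell, mem_Ico, le_div_iff₀ ha, div_lt_iff₀ ha]

/-- The left end point of the cell containing `y`. -/
def cellPoint (a y : ℝ) : ℝ := ⌊y / a⌋₊ * a

theorem measurable_cellPoint (a : ℝ) : Measurable (cellPoint a) :=
  (measurable_from_nat.comp (Nat.measurable_floor.comp (measurable_id.div_const a))).mul_const a

theorem integral_cellPoint {a : ℝ} (ha : 0 < a) (ν : Measure ℝ) [IsProbabilityMeasure ν]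
    (hν : ∀ᵐ y ∂ν, y ∈ Icc (0 : ℝ) 1) (q : ℝ → ℝ) :
    ∫ y, q (cellPoint a y) ∂ν
      = ∑ j ∈ Finset.range (⌊1 / a⌋₊ + 1), ν.real (cell a j) * q (j * a) := by
  have h1 : (fun y => q (cellPoint a y)) =ᵐ[ν] fun y =>
      ∑ j ∈ Finset.range (⌊1 / a⌋₊ + 1), (cell a j).indicator (fun _ => q (j * a)) y := by
    filter_upwards [hν] with y hy
    rw [Finset.sum_eq_single ⌊y / a⌋₊]
    · rw [indicator_of_mem ((mem_cell_iff ha hy.1 _).2 rfl), cellPoint]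
    · intro j _ hj
      rw [indicator_of_notMem]
      rw [mem_cell_iff ha hy.1]
      exact fun h => hj h.symm
    · intro h
      exfalso
      apply h
      rw [Finset.mem_range, Nat.lt_succ_iff]
      exact Nat.floor_le_floor (by gcongr; exact hy.2)
  rw [integral_congr_ae h1, integral_finsetSum]
  · refine Finset.sum_congr rfl fun j _ => ?_
    rw [integral_indicator_const _ (measurableSet_cell a j), smul_eq_mul]
  · intro j _
    exact (integrable_const _).indicator (measurableSet_cell a j)

/-- Once the points are moved to the grid, both convolutions are finite sums of translates of `k`,
each of `L¹` norm one, weighted by the cell masses. -/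
theorem lintegral_conv_cellPoint_sub_le {a : ℝ} (ha : 0 < a) (ν μ : Measure ℝ)
    [IsProbabilityMeasure ν] [IsProbabilityMeasure μ] (hν : ∀ᵐ y ∂ν, y ∈ Icc (0 : ℝ) 1)
    (hμ : ∀ᵐ y ∂μ, y ∈ Icc (0 : ℝ) 1) {k : ℝ → ℝ} (hk : Integrable k)
    (hk1 : ∫⁻ t, ‖k t‖ₑ = 1) :
    ∫⁻ t, ‖∫ y, k (t - cellPoint a y) ∂ν - ∫ y, k (t - cellPoint a y) ∂μ‖ₑ
      ≤ ENNReal.ofReal (cellDev a ν μ) := by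
  have h1 : ∀ j : ℕ, AEMeasurable
      (fun t => ‖(ν.real (cell a j) - μ.real (cell a j)) * k (t - j * a)‖ₑ) := fun j =>
    ((hk.comp_sub_right (j * a)).const_mul _).aestronglyMeasurable.enorm
  calc ∫⁻ t, ‖∫ y, k (t - cellPoint a y) ∂ν - ∫ y, k (t - cellPoint a y) ∂μ‖ₑ
      ≤ ∫⁻ t, ∑ j ∈ Finset.range (⌊1 / a⌋₊ + 1),
          ‖(ν.real (cell a j) - μ.real (cell a j)) * k (t - j * a)‖ₑ := by
        apply lintegral_mono
        intro t
        simp only [integral_cellPoint ha ν hν fun x => k (t - x),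
          integral_cellPoint ha μ hμ fun x => k (t - x), ← Finset.sum_sub_distrib, ← sub_mul]
        exact enorm_sum_le _ _
    _ = ∑ j ∈ Finset.range (⌊1 / a⌋₊ + 1),
          ENNReal.ofReal |ν.real (cell a j) - μ.real (cell a j)| := by
        rw [lintegral_finsetSum' _ fun j _ => h1 j]
        refine Finset.sum_congr rfl fun j _ => ?_
        simp_rw [enorm_mul]
        rw [lintegral_const_mul' _ _ (by simp),
          lintegral_sub_right_eq_self (fun t => ‖k t‖ₑ) (j * a), hk1, mul_one,
          ← ofReal_norm, Real.norm_eq_abs]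
    _ = ENNReal.ofReal (cellDev a ν μ) := by
        rw [cellDev, ENNReal.ofReal_sum_of_nonneg fun j _ => abs_nonneg _]

/-- Each measure is moved to the grid, by at most `a`, at cost `ε`. No density is needed, so `ν` may
be an empirical measure. -/
theorem lintegral_conv_measure_sub_le {a : ℝ} (ha : 0 < a) (ν μ : Measure ℝ)
    [IsProbabilityMeasure ν] [IsProbabilityMeasure μ] (hν : ∀ᵐ y ∂ν, y ∈ Icc (0 : ℝ) 1)
    (hμ : ∀ᵐ y ∂μ, y ∈ Icc (0 : ℝ) 1) {k : ℝ → ℝ} (hk : Integrable k) (hkm : Measurable k)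
    (hk1 : ∫⁻ t, ‖k t‖ₑ = 1) {ε : ENNReal}
    (hε : ∀ s, 0 ≤ s → s ≤ a → ∫⁻ t, ‖k (t - s) - k t‖ₑ ≤ ε) :
    ∫⁻ t, ‖∫ y, k (t - y) ∂ν - ∫ y, k (t - y) ∂μ‖ₑ
      ≤ ε + ENNReal.ofReal (cellDev a ν μ) + ε := by
  have hc : ∀ y ∈ Icc (0 : ℝ) 1, ∫⁻ t, ‖k (t - y) - k (t - cellPoint a y)‖ₑ ≤ ε := by
    intro y hy
    have h1 := Nat.floor_le (div_nonneg hy.1 ha.le)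
    have h2 := Nat.lt_floor_add_one (y / a)
    rw [le_div_iff₀ ha] at h1
    rw [div_lt_iff₀ ha] at h2
    have h3 := hε (y - cellPoint a y) (by rw [cellPoint]; linarith) (by rw [cellPoint]; linarith)
    rw [← lintegral_sub_right_eq_self _ (cellPoint a y)] at h3
    refine le_trans (le_of_eq (lintegral_congr fun t => ?_)) h3
    rw [show t - cellPoint a y - (y - cellPoint a y) = t - y by ring]
  have hcm := measurable_cellPoint a
  have hA := lintegral_conv_sub_le hk hkm ν hcm (hν.mono hc)
  have hB := lintegral_conv_sub_le hk hkm μ hcm (hμ.mono hc)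
  have hC := lintegral_conv_cellPoint_sub_le ha ν μ hν hμ hk hk1
  have i1 := (integrable_prod_translate hk hkm ν measurable_id).integral_prod_left
  have i2 := (integrable_prod_translate hk hkm ν hcm).integral_prod_left
  have i3 := (integrable_prod_translate hk hkm μ hcm).integral_prod_left
  simp only [id] at i1
  calc ∫⁻ t, ‖∫ y, k (t - y) ∂ν - ∫ y, k (t - y) ∂μ‖ₑ
      ≤ ∫⁻ t, (‖∫ y, k (t - y) ∂ν - ∫ y, k (t - cellPoint a y) ∂ν‖ₑ
          + ‖∫ y, k (t - cellPoint a y) ∂ν - ∫ y, k (t - cellPoint a y) ∂μ‖ₑ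
          + ‖∫ y, k (t - y) ∂μ - ∫ y, k (t - cellPoint a y) ∂μ‖ₑ) := by
        apply lintegral_mono
        intro t
        have : ∫ y, k (t - y) ∂ν - ∫ y, k (t - y) ∂μ
          = (∫ y, k (t - y) ∂ν - ∫ y, k (t - cellPoint a y) ∂ν)
          + (∫ y, k (t - cellPoint a y) ∂ν - ∫ y, k (t - cellPoint a y) ∂μ)
          - (∫ y, k (t - y) ∂μ - ∫ y, k (t - cellPoint a y) ∂μ) := by ring
        simp only [this]
        exact enorm_sub_le.trans (add_le_add_left (enorm_add_le _ _) _)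
    _ ≤ _ := by
        have m1 : AEMeasurable fun t =>
            ‖∫ y, k (t - y) ∂ν - ∫ y, k (t - cellPoint a y) ∂ν‖ₑ :=
          (i1.sub i2).aestronglyMeasurable.enorm
        have m2 : AEMeasurable fun t =>
            ‖∫ y, k (t - cellPoint a y) ∂ν - ∫ y, k (t - cellPoint a y) ∂μ‖ₑ :=
          (i2.sub i3).aestronglyMeasurable.enorm
        rw [lintegral_add_left' (m1.fun_add m2), lintegral_add_left' m1]
        gcongr

/-- Convolution with a probability density `k` supported near `0` is close to the identity. -/
theorem lintegral_conv_density_sub_le {F k : ℝ → ℝ} (hF : Integrable F) (hFm : Measurable F)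
    (hF0 : ∀ t, 0 ≤ F t) (hkm : Measurable k) (hk0 : ∀ t, 0 ≤ k t)
    (hk1 : ∫⁻ t, ‖k t‖ₑ = 1) {b : ℝ} (hkb : ∀ t, b < |t| → k t = 0) {ε : ENNReal}
    (hε : ∀ s, |s| ≤ b → ∫⁻ t, ‖F (t - s) - F t‖ₑ ≤ ε) :
    ∫⁻ t, ‖∫ y, k (t - y) ∂volume.withDensity (fun y => ENNReal.ofReal (F y)) - F t‖ₑ ≤ ε := by
  set κ := volume.withDensity fun y => ENNReal.ofReal (k y)
  have hκ : IsProbabilityMeasure κ := by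
    constructor
    rw [withDensity_apply _ MeasurableSet.univ, setLIntegral_univ, ← hk1]
    refine lintegral_congr fun t => ?_
    rw [← ofReal_norm, Real.norm_of_nonneg (hk0 t)]
  have hint : ∀ (p q : ℝ → ℝ), Measurable p → (∀ t, 0 ≤ p t) →
      ∫ y, q y ∂volume.withDensity (fun y => ENNReal.ofReal (p y)) = ∫ y, p y * q y := by
    intro p q hp hp0
    rw [integral_withDensity_eq_integral_toReal_smul hp.ennreal_ofReal (by simp)]
    refine integral_congr_ae (ae_of_all _ fun y => ?_)
    simp [ENNReal.toReal_ofReal (hp0 y)]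
  -- The roles are exchanged: by commutativity the convolution averages translates of `F` over the
  -- law with density `k`, and moving all its points to `0` returns `F`.
  have h := lintegral_conv_sub_le hF hFm κ (c := fun _ => 0) measurable_const (ε := ε) ?_
  · refine le_trans (le_of_eq ?_) h
    refine lintegral_congr fun t => ?_
    congr 1
    simp only [sub_zero, integral_const, probReal_univ, one_smul]
    congr 1
    rw [hint F _ hFm hF0, hint k _ hkm hk0, ← integral_sub_left_eq_self _ volume t]
    refine integral_congr_ae (ae_of_all _ fun y => ?_)
    simp only [sub_sub_cancel]
    ring
  · have hb : ∀ᵐ y ∂κ, |y| ≤ b := by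
      rw [ae_withDensity_iff hkm.ennreal_ofReal]
      refine ae_of_all _ fun y hy => ?_
      by_contra hc
      rw [hkb y (not_le.1 hc)] at hy
      simp at hy
    filter_upwards [hb] with y hy
    simpa using hε y hy

/-! ### Reflection at the end points -/

/-- The parts of `e` on `[-1, 0]` and `[1, 2]` are reflected into `[0, 1]`. -/
def reflectUnit (e : ℝ → ℝ) (t : ℝ) : ℝ := e t + e (-t) + e (2 - t)

theorem integral_reflectUnit {e : ℝ → ℝ} (he : Integrable e) :
    ∫ t in (0 : ℝ)..1, reflectUnit e t = ∫ t in (-1 : ℝ)..2, e t := by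
  have hi : ∀ a b, IntervalIntegrable e volume a b := fun a b => he.intervalIntegrable
  have h1 : IntervalIntegrable (fun t => e (-t)) volume 0 1 := he.comp_neg.intervalIntegrable
  have h2 : IntervalIntegrable (fun t => e (2 - t)) volume 0 1 :=
    (he.comp_sub_left 2).intervalIntegrable
  simp only [reflectUnit]
  rw [intervalIntegral.integral_add ((hi 0 1).add h1) h2, intervalIntegral.integral_add (hi 0 1) h1,
    intervalIntegral.integral_comp_neg, intervalIntegral.integral_comp_sub_left,
    ← intervalIntegral.integral_add_adjacent_intervals (hi (-1) 0) (hi 0 2),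
    ← intervalIntegral.integral_add_adjacent_intervals (hi 0 1) (hi 1 2)]
  norm_num
  ring

theorem integrable_reflectUnit {e : ℝ → ℝ} (he : Integrable e) : Integrable (reflectUnit e) :=
  (he.add he.comp_neg).add (he.comp_sub_left 2)

/-- As `F` vanishes off `[0, 1]`, whatever is folded back is already part of the error on the line,
and folding cannot increase an `L¹` norm. -/
theorem integral_abs_reflectUnit_sub_le {e F : ℝ → ℝ} (he : Integrable e) (hF : Integrable F)
    (hF0 : ∀ t, t ∉ Icc (0 : ℝ) 1 → F t = 0) :
    ∫ t, |reflectUnit e t - F t| ∂unitVol ≤ ∫ t, |e t - F t| := by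
  have hi : Integrable fun t => |e t - F t| := (he.sub hF).abs
  calc ∫ t, |reflectUnit e t - F t| ∂unitVol
      ≤ ∫ t, reflectUnit (fun t => |e t - F t|) t ∂unitVol := by
        apply integral_mono_ae
        · exact ((integrable_reflectUnit he).sub hF).abs.restrict
        · exact (integrable_reflectUnit hi).restrict
        -- At the end points the reflected argument lies in `[0, 1]` again, where `F` need not
        -- vanish.
        have hne : ∀ᵐ t ∂unitVol, t ≠ 0 ∧ t ≠ 1 :=
          ae_restrict_of_ae ((Measure.ae_ne volume 0).and (Measure.ae_ne volume 1))
        filter_upwards [ae_mem_unit, hne] with t ht h01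
        have h0 : 0 < t := lt_of_le_of_ne ht.1 (Ne.symm h01.1)
        have h1 : t < 1 := lt_of_le_of_ne ht.2 h01.2
        have e1 : F (-t) = 0 := hF0 _ fun h => by have := h.1; linarith
        have e2 : F (2 - t) = 0 := hF0 _ fun h => by have := h.2; linarith
        simp only [reflectUnit, e1, e2, sub_zero]
        rw [show e t + e (-t) + e (2 - t) - F t = (e t - F t) + e (-t) + e (2 - t) by ring]
        exact abs_add_three _ _ _
    _ = ∫ t in (-1 : ℝ)..2, |e t - F t| := by
        rw [integral_unitVol, integral_reflectUnit hi]
    _ ≤ ∫ t, |e t - F t| := by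
        rw [intervalIntegral.integral_of_le (by norm_num)]
        exact setIntegral_le_integral hi (ae_of_all _ fun t => abs_nonneg _)

/-! ### The modified kernel estimate from the first terms of a sequence -/

/-- The rescaled kernel. -/
def scaledKernel (K : ℝ → ℝ) (b : ℝ) (u : ℝ) : ℝ := K (u / b) / b

section Kernel

variable {K : ℝ → ℝ} {b : ℝ}

theorem integrable_scaledKernel (hK : Integrable K) (hb : 0 < b) :
    Integrable (scaledKernel K b) :=
  (hK.comp_div hb.ne').div_const b

/-- Scale invariance of the `L¹` norm. This is why cells of length a small fixed fraction of the
bandwidth suffice. -/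
theorem lintegral_scaledKernel_sub (hK : Integrable K) (hb : 0 < b) (s : ℝ) :
    ∫⁻ t, ‖scaledKernel K b (t - s) - scaledKernel K b t‖ₑ = ∫⁻ t, ‖K (t - s / b) - K t‖ₑ := by
  have hi := integrable_scaledKernel hK hb
  rw [← ofReal_integral_norm_eq_lintegral_enorm
      (f := fun t => scaledKernel K b (t - s) - scaledKernel K b t) ((hi.comp_sub_right s).sub hi),
    ← ofReal_integral_norm_eq_lintegral_enorm
      (f := fun t => K (t - s / b) - K t) ((hK.comp_sub_right (s / b)).sub hK)]
  congr 1
  have h1 : ∀ t, ‖scaledKernel K b (t - s) - scaledKernel K b t‖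
      = (fun u => ‖K (u - s / b) - K u‖ / b) (t / b) := by
    intro t
    simp only [scaledKernel]
    rw [← sub_div, norm_div, Real.norm_of_nonneg hb.le, sub_div]
  simp_rw [h1]
  rw [Measure.integral_comp_div (fun u => ‖K (u - s / b) - K u‖ / b) b, integral_div,
    abs_of_pos hb, smul_eq_mul]
  field_simp

theorem integral_scaledKernel (hb : 0 < b) : ∫ t, scaledKernel K b t = ∫ t, K t := by
  simp only [scaledKernel]
  rw [Measure.integral_comp_div (fun u => K u / b) b, integral_div, abs_of_pos hb, smul_eq_mul]
  field_simp

theorem lintegral_enorm_scaledKernel (hK : Integrable K) (hK0 : ∀ t, 0 ≤ K t)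
    (hK1 : ∫ t, K t = 1) (hb : 0 < b) : ∫⁻ t, ‖scaledKernel K b t‖ₑ = 1 := by
  rw [← ofReal_integral_norm_eq_lintegral_enorm (integrable_scaledKernel hK hb)]
  have : ∀ t, ‖scaledKernel K b t‖ = scaledKernel K b t := fun t =>
    Real.norm_of_nonneg (div_nonneg (hK0 _) hb.le)
  simp_rw [this]
  rw [integral_scaledKernel hb, hK1, ENNReal.ofReal_one]

theorem scaledKernel_eq_zero (hKs : ∀ t, 1 < |t| → K t = 0) (hb : 0 < b) {t : ℝ}
    (ht : b < |t|) : scaledKernel K b t = 0 := by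
  rw [scaledKernel, hKs, zero_div]
  rwa [abs_div, abs_of_pos hb, one_lt_div hb]

end Kernel

/-- The empirical measure of the first `r` terms of a sequence. -/
def empMeasure (x : ℕ → ℝ) (r : ℕ) : Measure ℝ :=
  (r : ENNReal)⁻¹ • ∑ j ∈ Finset.range r, Measure.dirac (x j)

theorem isProbabilityMeasure_empMeasure (x : ℕ → ℝ) {r : ℕ} (hr : 0 < r) :
    IsProbabilityMeasure (empMeasure x r) := by
  constructor
  rw [empMeasure, Measure.smul_apply, Measure.finsetSum_apply]
  simp only [measure_univ, Finset.sum_const, Finset.card_range, nsmul_eq_mul, mul_one, smul_eq_mul]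
  exact ENNReal.inv_mul_cancel (by simpa using hr.ne') (by simp)

theorem integral_empMeasure (x : ℕ → ℝ) (r : ℕ) (q : ℝ → ℝ) :
    ∫ y, q y ∂empMeasure x r = (r : ℝ)⁻¹ * ∑ j ∈ Finset.range r, q (x j) := by
  rw [empMeasure, integral_smul_measure,
    integral_finsetSum_measure fun j _ => integrable_dirac (by simp)]
  simp

theorem empMeasure_real (x : ℕ → ℝ) (r : ℕ) {A : Set ℝ} (hA : MeasurableSet A) :
    (empMeasure x r).real A = (r : ℝ)⁻¹ * ∑ j ∈ Finset.range r, A.indicator 1 (x j) := by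
  rw [← integral_empMeasure, integral_indicator_one hA]

theorem ae_empMeasure {x : ℕ → ℝ} {p : ℝ → Prop} (hp : MeasurableSet {y | p y})
    (hx : ∀ j, p (x j)) (r : ℕ) : ∀ᵐ y ∂empMeasure x r, p y := by
  rw [ae_iff, empMeasure, Measure.smul_apply, Measure.finsetSum_apply]
  have : ∀ j, Measure.dirac (x j) {y | ¬ p y} = 0 := fun j => by
    change Measure.dirac (x j) {y | p y}ᶜ = 0
    rw [Measure.dirac_apply' _ hp.compl]
    simp [hx j]
  simp [this]

theorem kernelEst_eq_integral (K : ℝ → ℝ) (b : ℝ) (x : ℕ → ℝ) (r : ℕ) (t : ℝ) :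
    kernelEst K b ((Multiset.range r).map x) t
      = ∫ y, scaledKernel K b (t - y) ∂empMeasure x r := by
  rw [integral_empMeasure, kernelEst]
  simp only [Multiset.card_map, Multiset.card_range, Multiset.map_map, Function.comp_def,
    scaledKernel]
  rw [← Finset.sum_div]
  change 1 / (r * b) * ∑ j ∈ Finset.range r, K ((t - x j) / b) = _
  rw [one_div, mul_inv]; ring

theorem reflectedEst_eq_reflectUnit (K : ℝ → ℝ) (b : ℝ) (x : Multiset ℝ) :
    reflectedEst K b x = reflectUnit (kernelEst K b x) := rfl

theorem integrable_kernelEst {K : ℝ → ℝ} (hK : Integrable K) {b : ℝ} (hb : 0 < b)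
    (x : ℕ → ℝ) (r : ℕ) : Integrable (kernelEst K b ((Multiset.range r).map x)) := by
  have : kernelEst K b ((Multiset.range r).map x) = fun t =>
      (r : ℝ)⁻¹ * ∑ j ∈ Finset.range r, scaledKernel K b (t - x j) := by
    ext t
    rw [kernelEst_eq_integral, integral_empMeasure _ _ fun y => scaledKernel K b (t - y)]
  rw [this]
  exact (integrable_finsetSum _ fun j _ =>
    (integrable_scaledKernel hK hb).comp_sub_right (x j)).const_mul _

/-- Each bump lives on `[x - b, x + b] ⊆ [-1, 2]` because `b ≤ 1`, and this is the range that the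
reflections fold back. -/
theorem integral_reflectedEst {K : ℝ → ℝ} (hK : Integrable K) (hK1 : ∫ t, K t = 1)
    (hKs : ∀ t, 1 < |t| → K t = 0) {b : ℝ} (hb : 0 < b) (hb1 : b ≤ 1) {x : ℕ → ℝ}
    (hx : ∀ j, x j ∈ Icc (0 : ℝ) 1) {r : ℕ} (hr : 0 < r) :
    ∫ t in (0 : ℝ)..1, reflectedEst K b ((Multiset.range r).map x) t = 1 := by
  have hi := integrable_scaledKernel hK hb
  rw [reflectedEst_eq_reflectUnit, integral_reflectUnit (integrable_kernelEst hK hb x r)]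
  have h1 : ∀ t, kernelEst K b ((Multiset.range r).map x) t
      = (r : ℝ)⁻¹ * ∑ j ∈ Finset.range r, scaledKernel K b (t - x j) := fun t => by
    rw [kernelEst_eq_integral, integral_empMeasure _ _ fun y => scaledKernel K b (t - y)]
  simp_rw [h1]
  rw [intervalIntegral.integral_const_mul, intervalIntegral.integral_finsetSum fun j _ =>
    (hi.comp_sub_right (x j)).intervalIntegrable]
  have h2 : ∀ j, ∫ t in (-1 : ℝ)..2, scaledKernel K b (t - x j) = 1 := by
    intro j
    rw [intervalIntegral.integral_of_le (by norm_num), setIntegral_eq_integral_of_ae_compl_eq_zero,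
      integral_sub_right_eq_self, integral_scaledKernel hb, hK1]
    -- The interval of integration omits `-1`, where the bump of `x = 0` with `b = 1` may be
    -- nonzero.
    filter_upwards [Measure.ae_ne volume (-1 : ℝ)] with t ht1 ht
    rcases lt_or_eq_of_le (hx j).1 with h0 | h0
    all_goals
      apply scaledKernel_eq_zero hKs hb
      rw [lt_abs]
      have := (hx j).2
      by_cases h2 : 2 < t
      · left; linarith
      · right
        have : t < -1 := lt_of_le_of_ne (not_lt.1 fun h => ht ⟨h, not_lt.1 h2⟩) ht1
        linarith
  simp_rw [h2]
  simp only [Finset.sum_const, Finset.card_range, nsmul_eq_mul, mul_one]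
  exact inv_mul_cancel₀ (by exact_mod_cast hr.ne')

theorem isPosDensity_modifiedEst {K : ℝ → ℝ} (hK : Integrable K) (hK0 : ∀ t, 0 ≤ K t)
    (hK1 : ∫ t, K t = 1) (hKs : ∀ t, 1 < |t| → K t = 0) {h : ℕ → ℝ} {x : ℕ → ℝ}
    (hx : ∀ j, x j ∈ Icc (0 : ℝ) 1) {r : ℕ} (hr : 0 < r) (hb : 0 < h r) (hb1 : h r ≤ 1) :
    IsPosDensity (modifiedEst K h ((Multiset.range r).map x)) := by
  have hr' : (0 : ℝ) < r := by exact_mod_cast hr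
  have hi : Integrable (reflectedEst K (h r) ((Multiset.range r).map x)) := by
    rw [reflectedEst_eq_reflectUnit]
    exact integrable_reflectUnit (integrable_kernelEst hK hb x r)
  have hk0 : ∀ t, 0 ≤ kernelEst K (h r) ((Multiset.range r).map x) t := fun t => by
    rw [kernelEst_eq_integral]
    exact integral_nonneg fun y => div_nonneg (hK0 _) hb.le
  have heq : modifiedEst K h ((Multiset.range r).map x) = fun t =>
      reflectedEst K (h r) ((Multiset.range r).map x) t * (r / (r + 1)) + 1 / (r + 1) := by
    ext t; simp [modifiedEst]
  rw [heq]
  refine ⟨?_, ?_, ?_⟩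
  · exact (hi.restrict.mul_const _).add (integrable_const _)
  · refine ae_of_all _ fun t => ?_
    have : 0 ≤ reflectedEst K (h r) ((Multiset.range r).map x) t :=
      add_nonneg (add_nonneg (hk0 _) (hk0 _)) (hk0 _)
    positivity
  · rw [intervalIntegral.integral_add (hi.intervalIntegrable.mul_const _) (by simp),
      intervalIntegral.integral_mul_const, integral_reflectedEst hK hK1 hKs hb hb1 hx hr]
    simp
    field_simp

/-- The modified estimate mixes in the uniform density with weight `1 / (r + 1)`, and two densities
are at `L¹` distance at most `2`. -/
theorem integral_abs_modifiedEst_sub_le {K : ℝ → ℝ} (hK : Integrable K) {h : ℕ → ℝ} {x : ℕ → ℝ}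
    {r : ℕ} (hb : 0 < h r) {F : ℝ → ℝ} (hF : Integrable F)
    (hF0 : ∀ t, t ∉ Icc (0 : ℝ) 1 → F t = 0) (hFp : IsPosDensity F) :
    ∫ t, |modifiedEst K h ((Multiset.range r).map x) t - F t| ∂unitVol
      ≤ (∫ t, |kernelEst K (h r) ((Multiset.range r).map x) t - F t|)
        + 2 * (1 / ((r : ℝ) + 1)) := by
  set R := reflectedEst K (h r) ((Multiset.range r).map x) with hR
  have hk := integrable_kernelEst hK hb x r
  have hi : Integrable R := by
    rw [hR, reflectedEst_eq_reflectUnit]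
    exact integrable_reflectUnit hk
  have heq : modifiedEst K h ((Multiset.range r).map x) = fun t =>
      R t * (r / (r + 1)) + 1 / (r + 1) := by
    ext t; simp [modifiedEst, hR]
  have i1 : Integrable (fun t => |R t - F t|) unitVol := (hi.sub hF).abs.restrict
  have i2 : Integrable (fun t => (1 + F t) * (1 / ((r : ℝ) + 1))) unitVol :=
    ((integrable_const 1).add hF.restrict).mul_const _
  calc ∫ t, |modifiedEst K h ((Multiset.range r).map x) t - F t| ∂unitVol
      ≤ ∫ t, (|R t - F t| + (1 + F t) * (1 / ((r : ℝ) + 1))) ∂unitVol := by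
        apply integral_mono_of_nonneg (ae_of_all _ fun t => abs_nonneg _) (i1.add i2)
        filter_upwards [hFp.pos] with t ht
        rw [heq]
        have hr1 : (r : ℝ) / (r + 1) = 1 - 1 / (r + 1) := by field_simp; ring
        have hr0 : 0 ≤ (r : ℝ) / (r + 1) := by positivity
        have hr2 : (0 : ℝ) ≤ 1 / (r + 1) := by positivity
        have e : R t * (r / (r + 1)) + 1 / (r + 1) - F t
            = (R t - F t) * (r / (r + 1)) + (1 - F t) * (1 / (r + 1)) := by
          rw [hr1]; ring
        simp only [e]
        refine (abs_add_le _ _).trans ?_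
        rw [abs_mul, abs_mul, abs_of_nonneg hr0, abs_of_nonneg hr2]
        have h1 : |R t - F t| * (r / (r + 1)) ≤ |R t - F t| :=
          mul_le_of_le_one_right (abs_nonneg _) (by rw [hr1]; linarith)
        have h2 : |1 - F t| ≤ 1 + F t := by rw [abs_le]; constructor <;> linarith
        exact add_le_add h1 (mul_le_mul_of_nonneg_right h2 hr2)
    _ = (∫ t, |R t - F t| ∂unitVol) + 2 * (1 / ((r : ℝ) + 1)) := by
        rw [integral_add i1 i2, integral_mul_const,
          integral_add (integrable_const 1) hF.restrict, integral_unitVol F,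
          hFp.integral_eq_one]
        simp
        norm_num
    _ ≤ _ := by
        refine add_le_add ?_ le_rfl
        rw [hR, reflectedEst_eq_reflectUnit]
        exact integral_abs_reflectUnit_sub_le hk hF hF0

/-- The modified kernel estimate is consistent in `L¹` along every sequence whose empirical
measures are close to the limit on the cells of length `h r / p`. -/
theorem tendsto_integral_modifiedEst_sub {K : ℝ → ℝ} (hKm : Measurable K) (hK : Integrable K)
    (hK0 : ∀ t, 0 ≤ K t) (hK1 : ∫ t, K t = 1) (hKs : ∀ t, 1 < |t| → K t = 0) {h : ℕ → ℝ}
    (hh : Tendsto h atTop (𝓝 0)) (hpos : ∀ᶠ r in atTop, 0 < h r) {x : ℕ → ℝ}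
    (hx : ∀ j, x j ∈ Icc (0 : ℝ) 1) {g : ℝ → ℝ} (hg : IsPosDensity g)
    (hdev : ∀ p : ℕ, 0 < p →
      Tendsto (fun r => cellDev (h r / p) (empMeasure x r) (densMeasure g)) atTop (𝓝 0)) :
    Tendsto (fun r => ∫ t, |modifiedEst K h ((Multiset.range r).map x) t - g t| ∂unitVol)
      atTop (𝓝 0) := by
  obtain ⟨g', hg'm, hgg'⟩ := hg.aemeasurable
  -- A Borel version of `g` on the whole line, nonnegative everywhere and zero off `[0, 1]`, to
  -- which translation applies.
  set F : ℝ → ℝ := (Icc (0 : ℝ) 1).indicator fun t => |g' t| with hFdef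
  have hFg : F =ᵐ[unitVol] g := by
    filter_upwards [hgg', hg.pos, ae_mem_unit] with t h1 h2 h3
    rw [hFdef, indicator_of_mem h3, ← h1, abs_of_pos h2]
  have hFp := hg.congr_ae hFg.symm
  have hFm : Measurable F := hg'm.abs.indicator measurableSet_Icc
  have hF0 : ∀ t, t ∉ Icc (0 : ℝ) 1 → F t = 0 := fun t ht => indicator_of_notMem ht _
  have hFnn : ∀ t, 0 ≤ F t := fun t => indicator_nonneg (fun _ _ => abs_nonneg _) t
  have hFi : Integrable F := by
    have := hFp.integrable
    rwa [integrableOn_iff_integrable_of_support_subset] at this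
    intro t ht
    by_contra hc
    exact ht (hF0 t hc)
  have hmeas : densMeasure g = volume.withDensity fun y => ENNReal.ofReal (F y) := by
    rw [densMeasure, withDensity_congr_ae (g := fun y => ENNReal.ofReal (F y))
      (by filter_upwards [hFg] with t ht; rw [ht]), ← withDensity_indicator measurableSet_Icc]
    congr 1
    ext t
    by_cases ht : t ∈ Icc (0 : ℝ) 1
    · rw [indicator_of_mem ht]
    · rw [indicator_of_notMem ht, hF0 t ht, ENNReal.ofReal_zero]
  have hprob := hg.isProbabilityMeasure_densMeasure
  have hcongr : ∀ r, ∫ t, |modifiedEst K h ((Multiset.range r).map x) t - g t| ∂unitVol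
      = ∫ t, |modifiedEst K h ((Multiset.range r).map x) t - F t| ∂unitVol := fun r => by
    apply integral_congr_ae
    filter_upwards [hFg] with t ht
    rw [ht]
  simp_rw [hcongr]
  rw [Metric.tendsto_nhds]
  intro ε hε
  obtain ⟨δ₁, hδ₁, hKδ⟩ := exists_lintegral_translate_le hK (by positivity : 0 < ε / 8)
  obtain ⟨δ₂, hδ₂, hFδ⟩ := exists_lintegral_translate_le hFi (by positivity : 0 < ε / 8)
  -- A shift by at most `h r / p` is, in units of the bandwidth, at most `1 / p < δ₁`. Below, the
  -- six errors of size at most `ε / 8` are two grid moves, the cell deviation, the smoothing bias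
  -- and twice `1 / (r + 1)`.
  obtain ⟨p, hp⟩ := exists_nat_gt (1 / δ₁)
  have hp0' : (0 : ℝ) < p := (by positivity : (0 : ℝ) < 1 / δ₁).trans hp
  have hp0 : 0 < p := by exact_mod_cast hp0'
  filter_upwards [hpos, hh.eventually (gt_mem_nhds hδ₂), eventually_gt_atTop 0,
    (hdev p hp0).eventually (gt_mem_nhds (by positivity : 0 < ε / 8)),
    (tendsto_one_div_add_atTop_nhds_zero_nat (𝕜 := ℝ)).eventually
      (gt_mem_nhds (by positivity : 0 < ε / 8))] with r hb hb2 hr hd hr2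
  have := isProbabilityMeasure_empMeasure x hr
  have hk := integrable_scaledKernel hK hb
  have hkm : Measurable (scaledKernel K (h r)) := (hKm.comp (measurable_id.div_const _)).div_const _
  have hk1 := lintegral_enorm_scaledKernel hK hK0 hK1 hb
  have ha : 0 < h r / p := by positivity
  have e1 := lintegral_conv_measure_sub_le ha (empMeasure x r) (densMeasure g)
    (ae_empMeasure measurableSet_Icc hx r) (IsPosDensity.densMeasure_ac.ae_le ae_mem_unit)
    hk hkm hk1 (ε := ENNReal.ofReal (ε / 8)) fun s hs0 hs => by
      rw [lintegral_scaledKernel_sub hK hb]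
      apply hKδ
      rw [abs_of_nonneg (by positivity), div_le_iff₀ hb]
      rw [div_lt_iff₀ hδ₁] at hp
      rw [le_div_iff₀ hp0'] at hs
      nlinarith
  have e2 := lintegral_conv_density_sub_le hFi hFm hFnn hkm
    (fun t => div_nonneg (hK0 _) hb.le) hk1 (fun t ht => scaledKernel_eq_zero hKs hb ht)
    (ε := ENNReal.ofReal (ε / 8)) fun s hs => hFδ s (hs.trans hb2.le)
  rw [← hmeas] at e2
  have hke := integrable_kernelEst hK hb x r
  have i1 := (integrable_prod_translate hk hkm (empMeasure x r) measurable_id).integral_prod_left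
  have i2 := (integrable_prod_translate hk hkm (densMeasure g) measurable_id).integral_prod_left
  simp only [id] at i1 i2
  have e3 : ENNReal.ofReal (∫ t, |kernelEst K (h r) ((Multiset.range r).map x) t - F t|)
      ≤ ENNReal.ofReal (ε / 8 + cellDev (h r / p) (empMeasure x r) (densMeasure g)
        + ε / 8 + ε / 8) := by
    have hcd : 0 ≤ cellDev (h r / p) (empMeasure x r) (densMeasure g) :=
      Finset.sum_nonneg fun j _ => abs_nonneg _
    have := ofReal_integral_norm_eq_lintegral_enorm
      (f := fun t => kernelEst K (h r) ((Multiset.range r).map x) t - F t) (hke.sub hFi)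
    simp only [Real.norm_eq_abs] at this
    rw [this, ENNReal.ofReal_add (by positivity) (by positivity),
      ENNReal.ofReal_add (by positivity) (by positivity),
      ENNReal.ofReal_add (by positivity) (by positivity)]
    refine le_trans ?_ (add_le_add e1 e2)
    rw [← lintegral_add_left']
    · apply lintegral_mono
      intro t
      beta_reduce
      rw [kernelEst_eq_integral, ← sub_add_sub_cancel _
        (∫ y, scaledKernel K (h r) (t - y) ∂densMeasure g)]
      exact enorm_add_le _ _
    · exact (i1.sub i2).aestronglyMeasurable.enorm
  have e4 := (ENNReal.ofReal_le_ofReal_iff (by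
    have : 0 ≤ cellDev (h r / p) (empMeasure x r) (densMeasure g) :=
      Finset.sum_nonneg fun j _ => abs_nonneg _
    positivity)).1 e3
  have e5 := integral_abs_modifiedEst_sub_le (x := x) hK hb hFi hF0 hFp
  rw [Real.dist_eq, sub_zero, abs_of_nonneg (integral_nonneg fun t => abs_nonneg _)]
  linarith

/-! ### Exponential inequalities and the Borel–Cantelli lemma -/

theorem ae_eventually_notMem_of_summable {Ω : Type*} [MeasurableSpace Ω] {P : Measure Ω}
    [IsFiniteMeasure P] {s : ℕ → Set Ω} {u : ℕ → ℝ} (hu : Summable u)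
    (hs : ∀ᶠ r in atTop, P.real (s r) ≤ u r) : ∀ᵐ ω ∂P, ∀ᶠ r in atTop, ω ∉ s r := by
  apply ae_eventually_notMem
  have h1 : Summable fun r => P.real (s r) :=
    Summable.of_norm_bounded_eventually_nat hu (by
      filter_upwards [hs] with r hr
      rwa [Real.norm_of_nonneg measureReal_nonneg])
  have := h1.tsum_ofReal_ne_top
  simpa using this

/-- Hoeffding's inequality for the absolute value of a centred sum. -/
theorem measureReal_abs_sum_sub_ge_le {Ω ι : Type*} [MeasurableSpace Ω] {μ : Measure Ω}
    [IsProbabilityMeasure μ] {X : ι → Ω → ℝ} (hind : iIndepFun X μ)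
    (hX : ∀ i, AEMeasurable (X i) μ) {a b : ℝ} (hab : ∀ i, ∀ᵐ ω ∂μ, X i ω ∈ Icc a b)
    (s : Finset ι) {ε : ℝ} (hε : 0 ≤ ε) :
    μ.real {ω | ε ≤ |∑ i ∈ s, (X i ω - ∫ ω', X i ω' ∂μ)|}
      ≤ 2 * Real.exp (-2 * ε ^ 2 / (s.card * (b - a) ^ 2)) := by
  have h1 : ∀ i, HasSubgaussianMGF (fun ω => X i ω - ∫ ω', X i ω' ∂μ) ((‖b - a‖₊ / 2) ^ 2) μ :=
    fun i => hasSubgaussianMGF_of_mem_Icc (hX i) (hab i)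
  have hc : -ε ^ 2 / (2 * ((∑ _i ∈ s, (‖b - a‖₊ / 2) ^ 2 : NNReal) : ℝ))
      = -2 * ε ^ 2 / (s.card * (b - a) ^ 2) := by
    push_cast
    rw [Finset.sum_const, nsmul_eq_mul, div_pow, Real.norm_eq_abs, sq_abs,
      show 2 * ((s.card : ℝ) * ((b - a) ^ 2 / 2 ^ 2)) = (s.card * (b - a) ^ 2) / 2 by ring,
      div_div_eq_mul_div]
    ring
  have h2 := HasSubgaussianMGF.measure_sum_ge_le_of_iIndepFun (s := s)
    (hind.comp (fun i x => x - ∫ ω', X i ω' ∂μ) fun i => measurable_id.sub_const _)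
    (c := fun _ => (‖b - a‖₊ / 2) ^ 2) (fun i _ => h1 i) hε
  have h3 := HasSubgaussianMGF.measure_sum_ge_le_of_iIndepFun (s := s)
    (hind.comp (fun i x => -(x - ∫ ω', X i ω' ∂μ)) fun i => (measurable_id.sub_const _).neg)
    (c := fun _ => (‖b - a‖₊ / 2) ^ 2) (fun i _ => (h1 i).neg) hε
  rw [hc] at h2 h3
  have hsub : {ω | ε ≤ |∑ i ∈ s, (X i ω - ∫ ω', X i ω' ∂μ)|} ⊆
      {ω | ε ≤ ∑ i ∈ s, (X i ω - ∫ ω', X i ω' ∂μ)} ∪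
      {ω | ε ≤ ∑ i ∈ s, -(X i ω - ∫ ω', X i ω' ∂μ)} := by
    intro ω hω
    have hω' : ε ≤ |∑ i ∈ s, (X i ω - ∫ ω', X i ω' ∂μ)| := hω
    rcases le_abs.1 hω' with h | h
    · exact Or.inl h
    · right
      simpa only [mem_ofPred_eq, Finset.sum_neg_distrib] using h
  calc _ ≤ _ := measureReal_mono hsub
    _ ≤ _ := measureReal_union_le _ _
    _ ≤ _ := by rw [two_mul]; exact add_le_add h2 h3

theorem measure_pi_abs_frequency_sub_ge_le (μ : Measure ℝ) [IsProbabilityMeasure μ] {r : ℕ}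
    (hr : 0 < r) {A : Set ℝ} (hA : MeasurableSet A) {ε : ℝ} (hε : 0 ≤ ε) :
    Measure.pi (fun _ : Fin r => μ)
      {v | ε ≤ |(r : ℝ)⁻¹ * ∑ j, A.indicator 1 (v j) - μ.real A|}
      ≤ ENNReal.ofReal (2 * Real.exp (-2 * r * ε ^ 2)) := by
  have hr' : (0 : ℝ) < r := by exact_mod_cast hr
  have hm : Measurable (A.indicator (1 : ℝ → ℝ)) := measurable_one.indicator hA
  have hind : iIndepFun (fun (j : Fin r) (v : Fin r → ℝ) => A.indicator (1 : ℝ → ℝ) (v j))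
      (Measure.pi fun _ : Fin r => μ) :=
    iIndepFun_pi fun _ => hm.aemeasurable
  have hmean : ∀ j : Fin r, ∫ v, A.indicator (1 : ℝ → ℝ) (v j) ∂Measure.pi (fun _ : Fin r => μ)
      = μ.real A := by
    intro j
    rw [← integral_indicator_one hA]
    have hmp := measurePreserving_eval (fun _ : Fin r => μ) j
    conv_rhs => rw [← hmp.map_eq]
    rw [integral_map hmp.measurable.aemeasurable hm.aestronglyMeasurable]
  have h := measureReal_abs_sum_sub_ge_le hind
    (fun j => (hm.comp (measurable_pi_apply j)).aemeasurable) (a := 0) (b := 1)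
    (fun j => ae_of_all _ fun v => by
      by_cases hv : v j ∈ A
      · simp [indicator_of_mem hv]
      · simp [indicator_of_notMem hv])
    Finset.univ (ε := r * ε) (by positivity)
  have hset : {v : Fin r → ℝ | ε ≤ |(r : ℝ)⁻¹ * ∑ j, A.indicator 1 (v j) - μ.real A|}
      = {v | r * ε ≤ |∑ j : Fin r, (A.indicator (1 : ℝ → ℝ) (v j)
        - ∫ v', A.indicator (1 : ℝ → ℝ) (v' j) ∂Measure.pi (fun _ : Fin r => μ))|} := by
    ext v
    simp only [mem_ofPred_eq, hmean, Finset.sum_sub_distrib, Finset.sum_const, Finset.card_univ,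
      Fintype.card_fin, nsmul_eq_mul]
    have : ∑ j, A.indicator (1 : ℝ → ℝ) (v j) - r * μ.real A
        = r * ((r : ℝ)⁻¹ * ∑ j, A.indicator 1 (v j) - μ.real A) := by field_simp
    rw [this, abs_mul, abs_of_pos hr', mul_le_mul_iff_right₀ hr']
  rw [hset, ← ofReal_measureReal]
  apply ENNReal.ofReal_le_ofReal
  refine h.trans (le_of_eq ?_)
  congr 2
  simp
  field_simp

/-! ### Conditionally i.i.d. sequences -/

/-- A bound uniform over the conditional laws survives integrating out `Z`. The event is joint in
`(Z, Y)` because the limiting frequencies depend on `Z` too. -/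
theorem measure_le_of_condDistrib {Ω E F : Type*} [MeasurableSpace Ω] [MeasurableSpace E]
    [MeasurableSpace F] [StandardBorelSpace F] [Nonempty F] {P : Measure Ω}
    [IsProbabilityMeasure P] {Z : Ω → E} {Y : Ω → F} (hZ : Measurable Z) (hY : Measurable Y)
    {ν : Ω → Measure F} (hν : ∀ᵐ ω ∂P, condDistrib Y Z P (Z ω) = ν ω) {B : Set (E × F)}
    (hB : MeasurableSet B) {c : ENNReal} (hc : ∀ ω, ν ω {y | (Z ω, y) ∈ B} ≤ c) :
    P {ω | (Z ω, Y ω) ∈ B} ≤ c := by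
  have h1 : P {ω | (Z ω, Y ω) ∈ B} = (P.map fun ω => (Z ω, Y ω)) B := by
    rw [Measure.map_apply (hZ.prodMk hY) hB]; rfl
  rw [h1, ← compProd_map_condDistrib hY.aemeasurable, Measure.compProd_apply hB,
    lintegral_map (Kernel.measurable_kernel_prodMk_left hB) hZ]
  calc _ ≤ ∫⁻ _, c ∂P := by
        apply lintegral_mono_ae
        filter_upwards [hν] with ω hω
        rw [hω]
        exact hc ω
    _ = c := by simp

theorem IsPosDensity.densMeasure_Iic {g : ℝ → ℝ} (hg : IsPosDensity g) (q : ℝ) :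
    densMeasure g (Iic q) = ENNReal.ofReal (cdfOf g (max 0 (min q 1))) := by
  have hmem : max 0 (min q 1) ∈ Icc (0 : ℝ) 1 :=
    ⟨le_max_left _ _, max_le zero_le_one (min_le_right _ _)⟩
  rw [← hg.densMeasure_Icc hmem]
  apply measure_congr
  -- For `q < 0` the clamped set is `{0}` rather than empty.
  have hne : ∀ᵐ t ∂densMeasure g, t ≠ 0 :=
    IsPosDensity.densMeasure_ac.ae_le (ae_restrict_of_ae (Measure.ae_ne volume 0))
  filter_upwards [IsPosDensity.densMeasure_ac.ae_le ae_mem_unit, hne] with t ht h0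
  have h0' : 0 < t := lt_of_le_of_ne ht.1 (Ne.symm h0)
  apply propext
  change t ≤ q ↔ 0 ≤ t ∧ t ≤ max 0 (min q 1)
  rw [le_max_iff, le_min_iff]
  exact ⟨fun h => ⟨ht.1, Or.inr ⟨h, ht.2⟩⟩, fun h => h.2.elim (fun h => by linarith) fun h => h.1⟩

section CondIID

variable {Ω E : Type*} [MeasurableSpace Ω] [MeasurableSpace E] {P : Measure Ω}
  {Z : Ω → E} {X : ℕ → Ω → ℝ} {g : Ω → ℝ → ℝ}

theorem IsIIDGiven.measurableSet_forall_le
    (hX : IsIIDGiven (MeasurableSpace.comap Z inferInstance) P X g)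
    (r : ℕ) (t : ℕ → ℝ) : MeasurableSet {ω | ∀ j < r, X j ω ≤ t j} := by
  have : {ω | ∀ j < r, X j ω ≤ t j} = ⋂ j ∈ Finset.range r, X j ⁻¹' Iic (t j) := by
    ext ω; simp
  rw [this]
  exact Finset.measurableSet_biInter _ fun j _ => hX.measurable j measurableSet_Iic

variable [IsProbabilityMeasure P]

theorem IsIIDGiven.measure_le_eq (hZ : Measurable Z)
    (hX : IsIIDGiven (MeasurableSpace.comap Z inferInstance) P X g) (r : ℕ) (t : ℕ → ℝ)
    (ht : ∀ j, t j ∈ Icc (0 : ℝ) 1) :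
    P.real {ω | ∀ j < r, X j ω ≤ t j} = ∫ ω, ∏ j ∈ Finset.range r, cdfOf (g ω) (t j) ∂P := by
  have h := hX.law r t ht
  rw [← integral_indicator_one (hX.measurableSet_forall_le r t), ← integral_condExp hZ.comap_le]
  exact integral_congr_ae h

theorem IsIIDGiven.ae_mem_Ioc (hZ : Measurable Z)
    (hX : IsIIDGiven (MeasurableSpace.comap Z inferInstance) P X g)
    (hg : ∀ ω, IsPosDensity (g ω)) : ∀ᵐ ω ∂P, ∀ j, X j ω ∈ Ioc (0 : ℝ) 1 := by
  have h1 : ∀ᵐ ω ∂P, ∀ j, X j ω ≤ 1 := by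
    rw [ae_all_iff]
    intro j
    have := hX.measure_le_eq hZ (j + 1) (fun _ => 1) (fun _ => by simp)
    simp only [(hg _).cdf_one, Finset.prod_const_one, integral_const, probReal_univ, smul_eq_mul,
      mul_one] at this
    rw [measureReal_def, ENNReal.toReal_eq_one_iff,
      ← mem_ae_iff_prob_eq_one (hX.measurableSet_forall_le (j + 1) fun _ => 1)] at this
    filter_upwards [this] with ω hω using hω j (Nat.lt_succ_self j)
  have h0 : ∀ᵐ ω ∂P, ∀ j, 0 < X j ω := by
    rw [ae_all_iff]
    intro j
    -- The thresholds `1` are harmless since all terms are at most `1`; the threshold `0` makes the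
    -- product vanish.
    have := hX.measure_le_eq hZ (j + 1) (fun i => if i = j then 0 else 1)
      (fun i => by split_ifs <;> simp)
    have hz : ∀ ω, ∏ i ∈ Finset.range (j + 1), cdfOf (g ω) (if i = j then 0 else 1) = 0 :=
      fun ω => Finset.prod_eq_zero (Finset.self_mem_range_succ j) (by simp [IsPosDensity.cdf_zero])
    simp only [hz, integral_zero] at this
    rw [measureReal_eq_zero_iff] at this
    filter_upwards [measure_eq_zero_iff_ae_notMem.1 this, h1] with ω hω h1ω
    by_contra hc
    apply hω
    intro i _
    by_cases hij : i = j
    · subst hij; simpa using hc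
    · simpa [hij] using h1ω i
  filter_upwards [h0, h1] with ω a b j using ⟨a j, b j⟩

/-- The conditional law of the first `r` terms of a conditionally i.i.d. sequence. -/
theorem IsIIDGiven.condDistrib_eq_pi (hZ : Measurable Z)
    (hX : IsIIDGiven (MeasurableSpace.comap Z inferInstance) P X g)
    (hg : ∀ ω, IsPosDensity (g ω)) (r : ℕ) :
    ∀ᵐ ω ∂P, condDistrib (fun ω (j : Fin r) => X j ω) Z P (Z ω)
      = Measure.pi fun _ : Fin r => densMeasure (g ω) := by
  have hY : Measurable fun ω (j : Fin r) => X j ω :=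
    measurable_pi_lambda _ fun j => hX.measurable j
  have key : ∀ q : Fin r → ℚ, ∀ᵐ ω ∂P,
      condDistrib (fun ω (j : Fin r) => X j ω) Z P (Z ω) (univ.pi fun j => Iic (q j : ℝ))
        = ∏ j, densMeasure (g ω) (Iic (q j : ℝ)) := by
    intro q
    -- The law is prescribed only for thresholds in `[0, 1]`. Clamping changes the event by a null
    -- set, as the terms lie in `(0, 1]`. Rational corners keep the exceptional sets countable in
    -- number.
    set t : ℕ → ℝ := fun j => if hj : j < r then max 0 (min (q ⟨j, hj⟩ : ℝ) 1) else 0 with ht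
    have htI : ∀ j, t j ∈ Icc (0 : ℝ) 1 := by
      intro j
      by_cases hj : j < r
      · simp only [ht, dif_pos hj]
        exact ⟨le_max_left _ _, max_le zero_le_one (min_le_right _ _)⟩
      · simp [ht, dif_neg hj]
    have hms : MeasurableSet (univ.pi fun j : Fin r => Iic (q j : ℝ)) :=
      MeasurableSet.univ_pi fun j => measurableSet_Iic
    have h1 := condDistrib_ae_eq_condExp (μ := P) hZ hY hms
    have h2 := hX.law r t htI
    have h3 : ((fun ω (j : Fin r) => X j ω) ⁻¹' (univ.pi fun j : Fin r => Iic (q j : ℝ))).indicator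
        (fun _ => (1 : ℝ)) =ᵐ[P] {ω | ∀ j < r, X j ω ≤ t j}.indicator (fun _ => (1 : ℝ)) := by
      filter_upwards [hX.ae_mem_Ioc hZ hg] with ω hω
      have : ω ∈ ((fun ω (j : Fin r) => X j ω) ⁻¹' (univ.pi fun j : Fin r => Iic (q j : ℝ))) ↔
          ω ∈ {ω | ∀ j < r, X j ω ≤ t j} := by
        simp only [mem_preimage, mem_univ_pi, mem_Iic, mem_ofPred_eq]
        constructor
        · intro h j hj
          simp only [ht, dif_pos hj]
          exact le_max_of_le_right (le_min (h ⟨j, hj⟩) (hω j).2)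
        · intro h j
          have := h j j.2
          simp only [ht, dif_pos j.2] at this
          rcases le_max_iff.1 this with h' | h'
          · exact absurd (hω j).1 (not_lt.2 h')
          · exact (le_min_iff.1 h').1
      simp only [indicator, this]
    filter_upwards [h1, h2, condExp_congr_ae (m := MeasurableSpace.comap Z inferInstance) h3]
      with ω a b c
    have h4 := a.trans (c.trans b)
    rw [← ofReal_measureReal, h4, Finset.prod_range fun j => ∫ s in (0 : ℝ)..t j, g ω s,
      ENNReal.ofReal_prod_of_nonneg]
    · refine Finset.prod_congr rfl fun j _ => ?_
      rw [(hg ω).densMeasure_Iic]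
      simp only [ht, dif_pos j.2]
      rfl
    · intro j _
      exact ((hg ω).bijOn_cdf.mapsTo (htI j)).1
  filter_upwards [ae_all_iff.2 key] with ω hω
  have := (hg ω).isProbabilityMeasure_densMeasure
  symm
  refine Measure.pi_eq_generateFrom (C := fun _ => ⋃ a : ℚ, {Iic (a : ℝ)})
    (fun _ => by rw [← Real.borel_eq_generateFrom_Iic_rat]; exact BorelSpace.measurable_eq.symm)
    (fun _ => Real.isPiSystem_Iic_rat) (fun _ => ⟨fun n => Iic ((n : ℚ) : ℝ), fun n => ?_,
      fun n => measure_lt_top _ _, ?_⟩) ?_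
  · exact mem_iUnion.2 ⟨n, rfl⟩
  · rw [iUnion_eq_univ_iff]
    intro x
    obtain ⟨n, hn⟩ := exists_nat_ge x
    exact ⟨n, by simpa using hn⟩
  · intro s hs
    have : ∀ j, ∃ a : ℚ, s j = Iic (a : ℝ) := fun j => by
      obtain ⟨a, ha⟩ := mem_iUnion.1 (hs j)
      exact ⟨a, ha⟩
    choose q hq using this
    rw [funext hq, hω q]

end CondIID

/-! ### Convergence of cell frequencies of conditionally i.i.d. sequences -/

theorem pairwise_disjoint_cell {a : ℝ} (ha : 0 < a) (T : Set ℕ) : T.PairwiseDisjoint (cell a) := by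
  intro i _ j _ hij
  rw [Function.onFun, Set.disjoint_left]
  intro y hi hj
  have hy : 0 ≤ y := le_trans (by positivity) hi.1
  exact hij (((mem_cell_iff ha hy i).1 hi).symm.trans ((mem_cell_iff ha hy j).1 hj))

/-- The union of the cells with index in `T`. -/
def cellUnion (a : ℝ) (T : Finset ℕ) : Set ℝ := ⋃ j ∈ T, cell a j

theorem measurableSet_cellUnion (a : ℝ) (T : Finset ℕ) : MeasurableSet (cellUnion a T) :=
  T.measurableSet_biUnion fun j _ => measurableSet_cell a j

theorem measureReal_cellUnion {a : ℝ} (ha : 0 < a) (ν : Measure ℝ) [IsFiniteMeasure ν]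
    (T : Finset ℕ) : ν.real (cellUnion a T) = ∑ j ∈ T, ν.real (cell a j) :=
  measureReal_biUnion_finset (pairwise_disjoint_cell ha _) fun j _ => measurableSet_cell a j

/-- The cells of positive and of negative deviation split the `ℓ¹` distance, and one group carries
at least half of it. Hoeffding's inequality is then needed for single sets only. -/
theorem exists_cellUnion_of_le_cellDev {a ε : ℝ} (ha : 0 < a) {ν μ : Measure ℝ}
    [IsFiniteMeasure ν] [IsFiniteMeasure μ] (h : ε ≤ cellDev a ν μ) :
    ∃ T ∈ (Finset.range (⌊1 / a⌋₊ + 1)).powerset,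
      ε / 2 ≤ |ν.real (cellUnion a T) - μ.real (cellUnion a T)| := by
  set R := Finset.range (⌊1 / a⌋₊ + 1)
  set d : ℕ → ℝ := fun j => ν.real (cell a j) - μ.real (cell a j)
  have hT : ∀ T : Finset ℕ, ν.real (cellUnion a T) - μ.real (cellUnion a T) = ∑ j ∈ T, d j := by
    intro T
    rw [measureReal_cellUnion ha, measureReal_cellUnion ha, ← Finset.sum_sub_distrib]
  have hsplit : cellDev a ν μ = |∑ j ∈ R with 0 ≤ d j, d j| + |∑ j ∈ R with ¬ 0 ≤ d j, d j| := by
    rw [cellDev, ← Finset.sum_filter_add_sum_filter_not R (fun j => 0 ≤ d j),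
      abs_of_nonneg (Finset.sum_nonneg fun j hj => (Finset.mem_filter.1 hj).2),
      abs_of_nonpos (Finset.sum_nonpos fun j hj => (not_le.1 (Finset.mem_filter.1 hj).2).le),
      ← Finset.sum_neg_distrib]
    congr 1
    · exact Finset.sum_congr rfl fun j hj => abs_of_nonneg (Finset.mem_filter.1 hj).2
    · exact Finset.sum_congr rfl fun j hj => abs_of_neg (not_le.1 (Finset.mem_filter.1 hj).2)
  by_cases h1 : ε / 2 ≤ |∑ j ∈ R with 0 ≤ d j, d j|
  · exact ⟨_, Finset.mem_powerset.2 (Finset.filter_subset _ _), by rwa [hT]⟩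
  · refine ⟨_, Finset.mem_powerset.2 (Finset.filter_subset (fun j => ¬ 0 ≤ d j) R), ?_⟩
    rw [hT]
    linarith

theorem measurable_densMeasure_real {Ω : Type*} {𝒢 : MeasurableSpace Ω} {g : Ω → ℝ → ℝ}
    (hg : ∀ ω, IsPosDensity (g ω))
    (hm : ∀ t ∈ Icc (0 : ℝ) 1, Measurable[𝒢] fun ω => cdfOf (g ω) t) {A : Set ℝ}
    (hA : MeasurableSet A) : Measurable[𝒢] fun ω => (densMeasure (g ω)).real A := by
  have hp : ∀ ω, IsProbabilityMeasure (densMeasure (g ω)) := fun ω =>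
    (hg ω).isProbabilityMeasure_densMeasure
  have h : Measurable[𝒢] fun ω => densMeasure (g ω) := by
    refine Measurable.measure_of_isPiSystem_of_isProbabilityMeasure
      (S := ⋃ a : ℚ, {Iic (a : ℝ)}) ?_ Real.isPiSystem_Iic_rat ?_
    · rw [← Real.borel_eq_generateFrom_Iic_rat]; exact BorelSpace.measurable_eq
    · intro s hs
      obtain ⟨q, rfl⟩ := mem_iUnion.1 hs
      simp_rw [(hg _).densMeasure_Iic]
      exact (hm _ ⟨le_max_left _ _, max_le zero_le_one (min_le_right _ _)⟩).ennreal_ofReal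
  exact ((Measure.measurable_coe hA).comp h).ennreal_toReal

section CondIID

variable {Ω E : Type*} [MeasurableSpace Ω] [MeasurableSpace E] {P : Measure Ω}
  [IsProbabilityMeasure P] {Z : Ω → E} {X : ℕ → Ω → ℝ} {g : Ω → ℝ → ℝ}

/-- Given `Z`, the terms are i.i.d. and the target frequency is a constant `m (Z ω)`; Hoeffding's
bound is the same for all values of `Z`. -/
theorem IsIIDGiven.measure_abs_emp_sub_ge_le (hZ : Measurable Z)
    (hX : IsIIDGiven (MeasurableSpace.comap Z inferInstance) P X g)
    (hg : ∀ ω, IsPosDensity (g ω))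
    (hm : ∀ t ∈ Icc (0 : ℝ) 1,
      Measurable[MeasurableSpace.comap Z inferInstance] fun ω => cdfOf (g ω) t)
    {r : ℕ} (hr : 0 < r) {A : Set ℝ} (hA : MeasurableSet A) {ε : ℝ} (hε : 0 ≤ ε) :
    P {ω | ε ≤ |(empMeasure (fun j => X j ω) r).real A - (densMeasure (g ω)).real A|}
      ≤ ENNReal.ofReal (2 * Real.exp (-2 * r * ε ^ 2)) := by
  obtain ⟨m, hmm, hmZ⟩ := (measurable_densMeasure_real hg hm hA).exists_eq_measurable_comp
  have hmZ' : ∀ ω, (densMeasure (g ω)).real A = m (Z ω) := fun ω => congrFun hmZ ω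
  have hY : Measurable fun ω (j : Fin r) => X j ω :=
    measurable_pi_lambda _ fun j => hX.measurable j
  have hind : Measurable (A.indicator (1 : ℝ → ℝ)) := measurable_one.indicator hA
  set B : Set (E × (Fin r → ℝ)) :=
    {p | ε ≤ |(r : ℝ)⁻¹ * ∑ j, A.indicator 1 (p.2 j) - m p.1|}
  have hB : MeasurableSet B := by
    refine measurableSet_le measurable_const (Measurable.abs ?_)
    refine ((Finset.measurable_fun_sum _ fun j _ => ?_).const_mul _).sub (hmm.comp measurable_fst)
    exact hind.comp ((measurable_pi_apply j).comp measurable_snd)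
  have h := measure_le_of_condDistrib hZ hY (hX.condDistrib_eq_pi hZ hg r) hB
    (c := ENNReal.ofReal (2 * Real.exp (-2 * r * ε ^ 2))) fun ω => by
      have := (hg ω).isProbabilityMeasure_densMeasure
      have h := measure_pi_abs_frequency_sub_ge_le (densMeasure (g ω)) hr hA hε
      rw [hmZ'] at h
      exact h
  refine le_trans (le_of_eq ?_) h
  congr 1
  ext ω
  simp only [mem_ofPred_eq, B]
  rw [empMeasure_real _ _ hA, hmZ', Finset.sum_range]

theorem IsIIDGiven.measure_cellDev_ge_le (hZ : Measurable Z)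
    (hX : IsIIDGiven (MeasurableSpace.comap Z inferInstance) P X g)
    (hg : ∀ ω, IsPosDensity (g ω))
    (hm : ∀ t ∈ Icc (0 : ℝ) 1,
      Measurable[MeasurableSpace.comap Z inferInstance] fun ω => cdfOf (g ω) t)
    {r : ℕ} (hr : 0 < r) {a : ℝ} (ha : 0 < a) {ε : ℝ} (hε : 0 ≤ ε) :
    P.real {ω | ε ≤ cellDev a (empMeasure (fun j => X j ω) r) (densMeasure (g ω))}
      ≤ 2 ^ (⌊1 / a⌋₊ + 1) * (2 * Real.exp (-2 * r * (ε / 2) ^ 2)) := by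
  set R := (Finset.range (⌊1 / a⌋₊ + 1)).powerset
  have hsub : {ω | ε ≤ cellDev a (empMeasure (fun j => X j ω) r) (densMeasure (g ω))} ⊆
      ⋃ T ∈ R, {ω | ε / 2 ≤ |(empMeasure (fun j => X j ω) r).real (cellUnion a T)
        - (densMeasure (g ω)).real (cellUnion a T)|} := by
    intro ω hω
    have := (hg ω).isProbabilityMeasure_densMeasure
    have := isProbabilityMeasure_empMeasure (fun j => X j ω) hr
    obtain ⟨T, hT, hle⟩ := exists_cellUnion_of_le_cellDev ha hω
    exact mem_biUnion (Finset.mem_coe.2 hT) hle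
  refine (measureReal_mono hsub (measure_ne_top _ _)).trans
    ((measureReal_biUnion_finset_le _ _).trans ?_)
  refine (Finset.sum_le_card_nsmul _ _ (2 * Real.exp (-2 * r * (ε / 2) ^ 2)) fun T _ => ?_).trans ?_
  · have h := hX.measure_abs_emp_sub_ge_le hZ hg hm hr (measurableSet_cellUnion a T)
      (by positivity : 0 ≤ ε / 2)
    exact ENNReal.toReal_le_of_le_ofReal (by positivity) h
  · rw [Finset.card_powerset, Finset.card_range, nsmul_eq_mul]
    push_cast
    exact le_rfl

theorem IsIIDGiven.ae_tendsto_cellDev (hZ : Measurable Z)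
    (hX : IsIIDGiven (MeasurableSpace.comap Z inferInstance) P X g)
    (hg : ∀ ω, IsPosDensity (g ω))
    (hm : ∀ t ∈ Icc (0 : ℝ) 1,
      Measurable[MeasurableSpace.comap Z inferInstance] fun ω => cdfOf (g ω) t)
    {a : ℕ → ℝ} (ha : ∀ᶠ r in atTop, 0 < a r)
    (hra : Tendsto (fun r : ℕ => (r : ℝ) * a r) atTop atTop) :
    ∀ᵐ ω ∂P, Tendsto
      (fun r => cellDev (a r) (empMeasure (fun j => X j ω) r) (densMeasure (g ω)))
      atTop (𝓝 0) := by
  have key : ∀ k : ℕ, ∀ᵐ ω ∂P, ∀ᶠ r in atTop,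
      ω ∉ {ω | 1 / ((k : ℝ) + 1) ≤
        cellDev (a r) (empMeasure (fun j => X j ω) r) (densMeasure (g ω))} := by
    intro k
    set ε : ℝ := 1 / ((k : ℝ) + 1)
    have hε : 0 < ε := by positivity
    have hsum : Summable fun r : ℕ => 2 * Real.exp (r * -(ε ^ 2 / 4)) :=
      (Real.summable_exp_nat_mul_iff.2 (by
        have : 0 < ε ^ 2 := by positivity
        linarith)).mul_left 2
    refine ae_eventually_notMem_of_summable hsum ?_
    -- These thresholds bound the number of cells by `r ε² / 8 + r ε² / 8`, half of Hoeffding's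
    -- exponent `2 r (ε / 2)² = r ε² / 2`. A summable `exp (-r ε² / 4)` remains.
    filter_upwards [ha, hra.eventually_ge_atTop (8 / ε ^ 2), eventually_gt_atTop 0,
      tendsto_natCast_atTop_atTop.eventually_ge_atTop (8 / ε ^ 2)] with r har hrar hr hr8
    refine (hX.measure_cellDev_ge_le hZ hg hm hr har hε.le).trans ?_
    have hr' : (0 : ℝ) < r := by exact_mod_cast hr
    have h1 : ((⌊1 / a r⌋₊ + 1 : ℕ) : ℝ) ≤ r * (ε ^ 2 / 4) := by
      push_cast
      have h2 : (⌊1 / a r⌋₊ : ℝ) ≤ 1 / a r := Nat.floor_le (by positivity)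
      have h3 : 1 / a r ≤ r * (ε ^ 2 / 8) := by
        rw [div_le_iff₀ har]
        rw [div_le_iff₀ (by positivity)] at hrar
        linarith
      have h4 : 1 ≤ r * (ε ^ 2 / 8) := by
        rw [div_le_iff₀ (by positivity)] at hr8
        linarith
      linarith
    have h2 : (2 : ℝ) ^ (⌊1 / a r⌋₊ + 1) ≤ Real.exp (r * (ε ^ 2 / 4)) := by
      calc (2 : ℝ) ^ (⌊1 / a r⌋₊ + 1) ≤ Real.exp 1 ^ (⌊1 / a r⌋₊ + 1) := by
            gcongr
            have := Real.add_one_le_exp (1 : ℝ)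
            linarith
        _ = Real.exp ((⌊1 / a r⌋₊ + 1 : ℕ) : ℝ) := by rw [← Real.exp_nat_mul, mul_one]
        _ ≤ _ := Real.exp_le_exp.2 h1
    calc _ ≤ Real.exp (r * (ε ^ 2 / 4)) * (2 * Real.exp (-2 * r * (ε / 2) ^ 2)) := by gcongr
      _ = 2 * Real.exp (r * -(ε ^ 2 / 4)) := by
        rw [mul_left_comm, ← Real.exp_add]
        congr 2
        ring
  filter_upwards [ae_all_iff.2 key] with ω hω
  rw [Metric.tendsto_nhds]
  intro ε hε
  obtain ⟨k, hk⟩ := exists_nat_one_div_lt hε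
  filter_upwards [hω k] with r hr
  rw [Real.dist_eq, sub_zero, abs_of_nonneg (Finset.sum_nonneg fun j _ => abs_nonneg _)]
  exact (not_le.1 hr).trans hk

end CondIID

/-! ### The number of events of a Poisson process -/

theorem countIn_eq_card {x : Multiset ℝ} {A : Set ℝ} (h : ∀ y ∈ x, y ∈ A) :
    countIn x A = Multiset.card x := by
  classical
  exact Multiset.countP_eq_card.2 h

/-- The total intensity is the same constant for every `ω`, so the conditional Poisson law of the
count is also the unconditional one. -/
theorem IsPoissonProcessGiven.measureReal_card_eq {Ω : Type*} {𝒢 : MeasurableSpace Ω}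
    [mΩ : MeasurableSpace Ω] (h𝒢 : 𝒢 ≤ mΩ) {P : Measure Ω}
    [IsProbabilityMeasure P] {S : Ω → Multiset ℝ} {lam : Ω → ℝ → ℝ}
    (hS : IsPoissonProcessGiven 𝒢 P S lam) {c : ℝ}
    (hc : ∀ ω, ∫ t in Icc (0 : ℝ) 1, lam ω t = c) (k : ℕ) :
    P.real {ω | Multiset.card (S ω) = k} = Real.exp (-c) * c ^ k / (Nat.factorial k : ℝ) := by
  have hae : {ω | Multiset.card (S ω) = k} =ᵐ[P]
      {ω | ∀ _ : Fin 1, countIn (S ω) (Icc 0 1) = k} := by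
    filter_upwards [hS.mem_Icc] with ω hω
    have : countIn (S ω) (Icc 0 1) = Multiset.card (S ω) := countIn_eq_card hω
    apply propext
    change Multiset.card (S ω) = k ↔ ∀ _ : Fin 1, countIn (S ω) (Icc 0 1) = k
    rw [this]
    exact ⟨fun h _ => h, fun h => h 0⟩
  have hms : MeasurableSet {ω | ∀ _ : Fin 1, countIn (S ω) (Icc 0 1) = k} := by
    have := hS.measurable_count (Icc 0 1) ordConnected_Icc (measurableSet_singleton k)
    convert this using 1
    ext ω
    exact ⟨fun h => h 0, fun h _ => h⟩
  have h := hS.law 1 (fun _ => Icc 0 1) (fun _ => ordConnected_Icc) (fun _ => subset_rfl)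
    (fun l l' hl => absurd (Subsingleton.elim l l') hl) (fun _ => k)
  rw [measureReal_congr hae, ← integral_indicator_one hms, ← integral_condExp h𝒢]
  refine (integral_congr_ae h).trans ?_
  simp [hc]

/-- For each `k`, the probabilities of exactly `k` events are summable in `m`. The first
Borel–Cantelli lemma needs nothing about the joint law of the counts. -/
theorem ae_tendsto_card {Ω : Type*} [MeasurableSpace Ω] {P : Measure Ω}
    [IsProbabilityMeasure P] {S : ℕ → Ω → Multiset ℝ} {Λ : ℕ → ℝ} (hΛ0 : ∀ m, 0 < Λ m)
    {α : ℝ} (hα : 1 < α) (hΛ : ∀ᶠ m : ℕ in atTop, α * Real.log m ≤ Λ m)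
    (hS : ∀ m k, P.real {ω | Multiset.card (S m ω) = k}
      = Real.exp (-Λ m) * Λ m ^ k / (Nat.factorial k : ℝ)) :
    ∀ᵐ ω ∂P, Tendsto (fun m => Multiset.card (S m ω)) atTop atTop := by
  -- The midpoint of `1 / α` and `1`. A part `(1 - c) Λ` of the exponent absorbs `Λ ^ k / k!`, and
  -- the rest gives `m ^ (-c α)` with `c α > 1`.
  set c : ℝ := (1 + α) / (2 * α) with hc
  have hcα : 1 < c * α := by
    rw [hc]; field_simp; linarith
  have hc1 : 0 < 1 - c := by
    rw [hc, sub_pos, div_lt_one (by positivity)]; linarith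
  have hc0 : 0 < c := by rw [hc]; positivity
  have key : ∀ k : ℕ, ∀ᵐ ω ∂P, ∀ᶠ m in atTop, ω ∉ {ω | Multiset.card (S m ω) = k} := by
    intro k
    have hsum : Summable fun m : ℕ => ((1 - c) ^ k)⁻¹ * (1 / (m : ℝ) ^ (c * α)) :=
      (Real.summable_one_div_nat_rpow.2 hcα).mul_left _
    refine ae_eventually_notMem_of_summable hsum ?_
    filter_upwards [hΛ, eventually_gt_atTop 0] with m hm hm0
    have hm0' : (0 : ℝ) < m := by exact_mod_cast hm0
    have h1 := Real.pow_div_factorial_le_exp ((1 - c) * Λ m) (by have := hΛ0 m; positivity) k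
    have h2 : Real.exp (-(c * Λ m)) ≤ 1 / (m : ℝ) ^ (c * α) := by
      rw [one_div, ← Real.rpow_neg hm0'.le, Real.rpow_def_of_pos hm0']
      apply Real.exp_le_exp.2
      nlinarith
    rw [hS]
    calc Real.exp (-Λ m) * Λ m ^ k / (Nat.factorial k : ℝ)
        = ((1 - c) ^ k)⁻¹ * (Real.exp (-Λ m) * (((1 - c) * Λ m) ^ k / (Nat.factorial k : ℝ))) := by
          rw [mul_pow]; field_simp
      _ ≤ ((1 - c) ^ k)⁻¹ * (Real.exp (-Λ m) * Real.exp ((1 - c) * Λ m)) := by gcongr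
      _ = ((1 - c) ^ k)⁻¹ * Real.exp (-(c * Λ m)) := by
          rw [← Real.exp_add]; congr 2; ring
      _ ≤ _ := by gcongr
  filter_upwards [ae_all_iff.2 key] with ω hω
  rw [tendsto_atTop]
  intro b
  have : ∀ᶠ m in atTop, ∀ k ∈ Finset.range b, Multiset.card (S m ω) ≠ k :=
    (eventually_all_finset _).2 fun k _ => hω k
  filter_upwards [this] with m hm
  by_contra hlt
  exact hm _ (Finset.mem_range.2 (not_le.1 hlt)) rfl

/-! ### The strong law of large numbers for square-root velocity functions -/

theorem IsWarp.hasDerivAt_warpInv {γ : ℝ → ℝ} (hγ : IsWarp γ) {t : ℝ} (ht : t ∈ Ioo (0 : ℝ) 1) :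
    HasDerivAt (warpInv γ) (warpDeriv (warpInv γ) t) t := by
  have hd := hγ.hasDens
  have hi := hd.warpInv
  have htI := Ioo_subset_Icc_self ht
  have hnhds : Icc (0 : ℝ) 1 ∈ 𝓝 t := Icc_mem_nhds ht.1 ht.2
  have hx : warpInv γ t ∈ Ioo (0 : ℝ) 1 := by
    have h0 := hi.strictMonoOn (left_mem_Icc.2 zero_le_one) htI ht.1
    have h1 := hi.strictMonoOn htI (right_mem_Icc.2 zero_le_one) ht.2
    rw [hi.map_zero] at h0
    rw [hi.map_one] at h1
    exact ⟨h0, h1⟩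
  have hder : HasDerivAt (warpInv γ) (warpDeriv γ (warpInv γ t))⁻¹ t := by
    refine HasDerivAt.of_local_left_inverse (hi.continuousOn.continuousAt hnhds)
      (hγ.hasDerivAt hx) (hγ.warpDeriv_pos (Ioo_subset_Icc_self hx)).ne' ?_
    filter_upwards [hnhds] with y hy using hd.invOn.2 hy
  have : warpDeriv (warpInv γ) t = (warpDeriv γ (warpInv γ t))⁻¹ :=
    hder.hasDerivWithinAt.derivWithin (uniqueDiffOn_Icc zero_lt_one t htI)
  rwa [this]

/-- By monotonicity `γ⁻¹ t ≤ s` means `t ≤ γ s`, which involves the random path at one fixed point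
only. -/
theorem measurable_uncurry_warpInv {Ω : Type*} [MeasurableSpace Ω] {γ : Ω → ℝ → ℝ}
    (hγ : ∀ ω, IsWarp (γ ω)) (hm : ∀ s ∈ Icc (0 : ℝ) 1, Measurable fun ω => γ ω s) :
    Measurable fun p : Ω × ℝ => warpInv (γ p.1) (max 0 (min p.2 1)) := by
  refine measurable_of_Iic fun s => ?_
  have hcl : ∀ t : ℝ, max 0 (min t 1) ∈ Icc (0 : ℝ) 1 := fun t =>
    ⟨le_max_left _ _, max_le zero_le_one (min_le_right _ _)⟩
  by_cases h0 : s < 0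
  · convert MeasurableSet.empty
    rw [eq_empty_iff_forall_notMem]
    intro p hp
    have := ((hγ p.1).hasDens.bijOn_warpInv.mapsTo (hcl p.2)).1
    exact absurd (this.trans hp) (not_le.2 h0)
  by_cases h1 : 1 ≤ s
  · convert MeasurableSet.univ
    rw [eq_univ_iff_forall]
    intro p
    exact ((hγ p.1).hasDens.bijOn_warpInv.mapsTo (hcl p.2)).2.trans h1
  have hs : s ∈ Icc (0 : ℝ) 1 := ⟨not_lt.1 h0, (not_le.1 h1).le⟩
  have : (fun p : Ω × ℝ => warpInv (γ p.1) (max 0 (min p.2 1))) ⁻¹' Iic s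
      = {p | max 0 (min p.2 1) ≤ γ p.1 s} := by
    ext p
    have hd := (hγ p.1).hasDens
    change warpInv (γ p.1) (max 0 (min p.2 1)) ≤ s ↔ max 0 (min p.2 1) ≤ γ p.1 s
    rw [← hd.strictMonoOn.le_iff_le (hd.bijOn_warpInv.mapsTo (hcl p.2)) hs, hd.invOn.2 (hcl p.2)]
  rw [this]
  exact measurableSet_le (measurable_const.max (measurable_snd.min measurable_const))
    ((hm s hs).comp measurable_fst)

/-- A pointwise limit of forward difference quotients. Joint measurability is what Fubini requires
later; the open interval leaves room for the forward step. -/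
theorem measurable_uncurry_warpDeriv_warpInv {Ω : Type*} [MeasurableSpace Ω] {γ : Ω → ℝ → ℝ}
    (hγ : ∀ ω, IsWarp (γ ω)) (hm : ∀ s ∈ Icc (0 : ℝ) 1, Measurable fun ω => γ ω s) :
    Measurable fun p : Ω × ℝ => (Ioo (0 : ℝ) 1).indicator (warpDeriv (warpInv (γ p.1))) p.2 := by
  have hG := measurable_uncurry_warpInv hγ hm
  set G : Ω × ℝ → ℝ := fun p => warpInv (γ p.1) (max 0 (min p.2 1)) with hGdef
  set u : ℕ → ℝ := fun n => 1 / ((n : ℝ) + 1)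
  have hu0 : ∀ n, 0 < u n := fun n => Nat.one_div_pos_of_nat
  have hu : Tendsto u atTop (𝓝 0) := tendsto_one_div_add_atTop_nhds_zero_nat
  set q : ℕ → Ω × ℝ → ℝ := fun n => (univ ×ˢ Ioo (0 : ℝ) 1).indicator
    fun p => (u n)⁻¹ * (G (p.1, p.2 + u n) - G p)
  have hq : ∀ n, Measurable (q n) := fun n =>
    (((hG.comp (measurable_fst.prodMk (measurable_snd.add_const _))).sub hG).const_mul _).indicator
      (MeasurableSet.univ.prod measurableSet_Ioo)
  refine measurable_of_tendsto_metrizable hq (tendsto_pi_nhds.2 fun p => ?_)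
  obtain ⟨ω, t⟩ := p
  by_cases ht : t ∈ Ioo (0 : ℝ) 1
  · have hmem : (ω, t) ∈ (univ ×ˢ Ioo (0 : ℝ) 1 : Set (Ω × ℝ)) := ⟨trivial, ht⟩
    have hd := (hasDerivAt_iff_tendsto_slope.1 ((hγ ω).hasDerivAt_warpInv ht))
    have htu : Tendsto (fun n => t + u n) atTop (𝓝[≠] t) := by
      refine tendsto_nhdsWithin_iff.2 ⟨by simpa using hu.const_add t, ?_⟩
      exact Eventually.of_forall fun n => by simpa using (hu0 n).ne'
    have hlim := hd.comp htu
    simp only [indicator_of_mem ht]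
    refine hlim.congr' ?_
    have hev : ∀ᶠ n in atTop, u n < 1 - t := hu.eventually (gt_mem_nhds (by linarith [ht.2]))
    filter_upwards [hev] with n hn
    have hn0 := hu0 n
    simp only [q, indicator_of_mem hmem, Function.comp, slope, vsub_eq_sub, smul_eq_mul,
      add_sub_cancel_left, hGdef]
    rw [min_eq_left (by linarith), min_eq_left ht.2.le, max_eq_right (by linarith [ht.1]),
      max_eq_right ht.1.le]
  · have hmem : (ω, t) ∉ (univ ×ˢ Ioo (0 : ℝ) 1 : Set (Ω × ℝ)) := fun h => ht h.2
    simp only [indicator_of_notMem ht, q, indicator_of_notMem hmem]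
    exact tendsto_const_nhds

theorem measurable_warp_apply {Ω : Type*} {γ : Ω → ℝ → ℝ} {s : ℝ} (hs : s ∈ Icc (0 : ℝ) 1) :
    Measurable[warpSigma γ] fun ω => γ ω s := by
  have h1 : Measurable[warpSigma γ] (warpPath γ) := comap_measurable _
  exact (measurable_pi_apply (⟨s, hs⟩ : Icc (0 : ℝ) 1)).comp h1

section SLLN

variable {Ω : Type*} [MeasurableSpace Ω] {P : Measure Ω} [IsProbabilityMeasure P]

/-- The strong law of large numbers for independent, uniformly bounded random variables with a
common mean. -/
theorem ae_tendsto_average_of_bounded {Y : ℕ → Ω → ℝ} (hind : iIndepFun Y P)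
    (hY : ∀ i, AEMeasurable (Y i) P) {M β : ℝ} (hM : 0 < M)
    (hb : ∀ i, ∀ᵐ ω ∂P, Y i ω ∈ Icc 0 M) (hβ : ∀ i, ∫ ω, Y i ω ∂P = β) :
    ∀ᵐ ω ∂P, Tendsto (fun n : ℕ => (n : ℝ)⁻¹ * ∑ i ∈ Finset.range n, Y i ω) atTop (𝓝 β) := by
  -- The variables need not be identically distributed, but Hoeffding's bound is exponentially small
  -- in `n` and Borel–Cantelli applies.
  have key : ∀ k : ℕ, ∀ᵐ ω ∂P, ∀ᶠ n : ℕ in atTop,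
      ω ∉ {ω | n * (1 / ((k : ℝ) + 1)) ≤ |∑ i ∈ Finset.range n, (Y i ω - ∫ ω', Y i ω' ∂P)|} := by
    intro k
    set ε : ℝ := 1 / ((k : ℝ) + 1)
    have hε : 0 < ε := by positivity
    have hsum : Summable fun n : ℕ => 2 * Real.exp (n * -(2 * ε ^ 2 / M ^ 2)) :=
      (Real.summable_exp_nat_mul_iff.2 (by
        have : 0 < 2 * ε ^ 2 / M ^ 2 := by positivity
        linarith)).mul_left 2
    refine ae_eventually_notMem_of_summable hsum ?_
    filter_upwards [eventually_gt_atTop 0] with n hn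
    have hn' : (0 : ℝ) < n := by exact_mod_cast hn
    refine (measureReal_abs_sum_sub_ge_le hind hY hb (Finset.range n) (by positivity)).trans
      (le_of_eq ?_)
    congr 2
    rw [Finset.card_range, sub_zero]
    field_simp
  filter_upwards [ae_all_iff.2 key] with ω hω
  rw [Metric.tendsto_nhds]
  intro ε hε
  obtain ⟨k, hk⟩ := exists_nat_one_div_lt hε
  filter_upwards [hω k, eventually_gt_atTop 0] with n h1 hn
  have hn' : (0 : ℝ) < n := by exact_mod_cast hn
  have h2 := not_le.1 h1
  simp only [hβ, Finset.sum_sub_distrib, Finset.sum_const, Finset.card_range, nsmul_eq_mul] at h2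
  have : (n : ℝ)⁻¹ * ∑ i ∈ Finset.range n, Y i ω - β
      = (n : ℝ)⁻¹ * (∑ i ∈ Finset.range n, Y i ω - n * β) := by field_simp
  rw [Real.dist_eq, this, abs_mul, abs_of_pos (inv_pos.2 hn')]
  calc _ < (n : ℝ)⁻¹ * (n * (1 / ((k : ℝ) + 1))) := by gcongr
    _ = 1 / ((k : ℝ) + 1) := by field_simp
    _ < ε := hk

/-- The strong law holds at each `t` off a null set depending on `t`; Fubini turns this into one
null set of `ω` off which convergence holds for almost every `t`. -/
theorem ae_ae_tendsto_average_srvf {γ : ℕ → Ω → ℝ → ℝ} (hγ : ∀ i ω, IsWarp (γ i ω))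
    (hmeas : ∀ i, Measurable (warpPath (γ i)))
    (hindep : iIndepFun (fun i => warpPath (γ i)) P) {β : ℝ}
    (hmean : ∀ i, ∀ t ∈ Icc (0 : ℝ) 1, ∫ ω, srvf (warpInv (γ i ω)) t ∂P = β)
    {M : ℝ} (hM : 0 < M)
    (hbdd : ∀ i, ∀ᵐ ω ∂P, ∀ t ∈ Icc (0 : ℝ) 1, srvf (warpInv (γ i ω)) t ∈ Icc 0 M) :
    ∀ᵐ ω ∂P, ∀ᵐ t ∂unitVol, Tendsto
      (fun n : ℕ => (n : ℝ)⁻¹ * ∑ i ∈ Finset.range n, srvf (warpInv (γ i ω)) t)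
      atTop (𝓝 β) := by
  set Y : ℕ → Ω → ℝ → ℝ := fun i ω t =>
    Real.sqrt ((Ioo (0 : ℝ) 1).indicator (warpDeriv (warpInv (γ i ω))) t)
  have hYs : ∀ i ω, ∀ t ∈ Ioo (0 : ℝ) 1, Y i ω t = srvf (warpInv (γ i ω)) t := fun i ω t ht => by
    simp only [Y, indicator_of_mem ht]; rfl
  have hYm : ∀ i, Measurable fun p : Ω × ℝ => Y i p.1 p.2 := fun i =>
    (measurable_uncurry_warpDeriv_warpInv (hγ i) fun s hs =>
      (measurable_warp_apply hs).mono (hmeas i).comap_le le_rfl).sqrt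
  have hY𝒢 : ∀ i t, Measurable[warpSigma (γ i)] fun ω => Y i ω t := fun i t => by
    let _ : MeasurableSpace Ω := warpSigma (γ i)
    exact ((measurable_uncurry_warpDeriv_warpInv (hγ i) fun s hs =>
      measurable_warp_apply hs).comp (measurable_id.prodMk measurable_const)).sqrt
  have hne : ∀ᵐ t ∂unitVol, t ∈ Ioo (0 : ℝ) 1 := by
    filter_upwards [ae_mem_unit, ae_restrict_of_ae (Measure.ae_ne volume (0 : ℝ)),
      ae_restrict_of_ae (Measure.ae_ne volume (1 : ℝ))] with t h1 h2 h3
    exact ⟨lt_of_le_of_ne h1.1 (Ne.symm h2), lt_of_le_of_ne h1.2 h3⟩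
  have hpt : ∀ t ∈ Ioo (0 : ℝ) 1, ∀ᵐ ω ∂P,
      Tendsto (fun n : ℕ => (n : ℝ)⁻¹ * ∑ i ∈ Finset.range n, Y i ω t) atTop (𝓝 β) := by
    intro t ht
    have htI := Ioo_subset_Icc_self ht
    choose c hc hcY using fun i => (hY𝒢 i t).exists_eq_measurable_comp
    have hind : iIndepFun (fun i ω => Y i ω t) P := by
      have : (fun i ω => Y i ω t) = fun i => c i ∘ warpPath (γ i) := funext hcY
      rw [this]
      exact hindep.comp c hc
    refine ae_tendsto_average_of_bounded hind
      (fun i => ((hY𝒢 i t).mono (hmeas i).comap_le le_rfl).aemeasurable) hM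
      (fun i => ?_) fun i => ?_
    · filter_upwards [hbdd i] with ω hω
      rw [hYs i ω t ht]
      exact hω t htI
    · simp_rw [hYs i _ t ht]
      exact hmean i t htI
  have hset : MeasurableSet {p : ℝ × Ω |
      Tendsto (fun n : ℕ => (n : ℝ)⁻¹ * ∑ i ∈ Finset.range n, Y i p.2 p.1) atTop (𝓝 β)} :=
    measurableSet_tendsto _ fun n => (Finset.measurable_fun_sum _ fun i _ =>
      (hYm i).comp measurable_swap).const_mul _
  have h1 : ∀ᵐ t ∂unitVol, ∀ᵐ ω ∂P,
      Tendsto (fun n : ℕ => (n : ℝ)⁻¹ * ∑ i ∈ Finset.range n, Y i ω t) atTop (𝓝 β) := by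
    filter_upwards [hne] with t ht using hpt t ht
  rw [Measure.ae_ae_comm hset] at h1
  filter_upwards [h1] with ω hω
  filter_upwards [hω, hne] with t h2 h3
  simpa only [hYs _ ω t h3] using h2

theorem ae_tendsto_l2Norm_average_srvf {γ : ℕ → Ω → ℝ → ℝ} (hγ : ∀ i ω, IsWarp (γ i ω))
    (hmeas : ∀ i, Measurable (warpPath (γ i)))
    (hindep : iIndepFun (fun i => warpPath (γ i)) P) {β : ℝ}
    (hmean : ∀ i, ∀ t ∈ Icc (0 : ℝ) 1, ∫ ω, srvf (warpInv (γ i ω)) t ∂P = β)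
    {M : ℝ} (hM : 0 < M)
    (hbdd : ∀ i, ∀ᵐ ω ∂P, ∀ t ∈ Icc (0 : ℝ) 1, srvf (warpInv (γ i ω)) t ∈ Icc 0 M) :
    ∀ᵐ ω ∂P, Tendsto (fun n : ℕ => l2Norm fun t =>
      (n : ℝ)⁻¹ * ∑ i ∈ Finset.range n, srvf (warpInv (γ i ω)) t - β) atTop (𝓝 0) := by
  filter_upwards [ae_ae_tendsto_average_srvf hγ hmeas hindep hmean hM hbdd,
    ae_all_iff.2 hbdd] with ω h1 h2
  have hm : ∀ i, AEMeasurable (srvf (warpInv (γ i ω))) unitVol := fun i => by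
    have hd := (hγ i ω).hasDens.warpInv
    exact (hd.isPosDensity.aemeasurable.congr hd.warpDeriv_ae.symm).sqrt
  have hlim : Tendsto (fun n : ℕ => ∫ t,
      ((n : ℝ)⁻¹ * ∑ i ∈ Finset.range n, srvf (warpInv (γ i ω)) t - β) ^ 2 ∂unitVol)
      atTop (𝓝 (∫ _, (0 : ℝ) ∂unitVol)) := by
    refine tendsto_integral_of_dominated_convergence (fun _ => (M + |β|) ^ 2) (fun n => ?_)
      (integrable_const _) (fun n => ?_) ?_
    · exact ((((Finset.aemeasurable_fun_sum _ fun i _ => hm i).const_mul _).sub_const _).pow_const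
        2).aestronglyMeasurable
    · filter_upwards [ae_mem_unit] with t ht
      rw [Real.norm_of_nonneg (sq_nonneg _), ← sq_abs]
      refine pow_le_pow_left₀ (abs_nonneg _) ((abs_sub _ _).trans (add_le_add_left ?_ _)) 2
      rw [abs_of_nonneg (mul_nonneg (by positivity) (Finset.sum_nonneg fun i _ => (h2 i t ht).1))]
      have : ∑ i ∈ Finset.range n, srvf (warpInv (γ i ω)) t ≤ n * M := by
        refine (Finset.sum_le_card_nsmul _ _ M fun i _ => (h2 i t ht).2).trans ?_
        rw [Finset.card_range, nsmul_eq_mul]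
      rcases Nat.eq_zero_or_pos n with rfl | hn
      · simpa using hM.le
      · have hn' : (0 : ℝ) < n := by exact_mod_cast hn
        rw [inv_mul_le_iff₀ hn']
        exact this
    · filter_upwards [h1] with t ht
      simpa using (ht.sub_const β).pow 2
  rw [integral_zero] at hlim
  have := (Real.continuous_sqrt.tendsto 0).comp hlim
  rw [Real.sqrt_zero] at this
  refine this.congr fun n => ?_
  rw [Function.comp, l2Norm, ← integral_unitVol fun t =>
    ((n : ℝ)⁻¹ * ∑ i ∈ Finset.range n, srvf (warpInv (γ i ω)) t - β) ^ 2]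

end SLLN

/-! ### Warped densities and the limit of the Karcher means -/

theorem IsWarp.hasDens_areaAct {γ f : ℝ → ℝ} (hγ : IsWarp γ) (hf : IsPosDensity f) :
    HasDens (cdfOf f ∘ γ) (areaAct f γ) :=
  hf.hasDens.comp hγ.hasDens

/-- The optimal warping from `f` to `(f; γ)` is `(F ∘ γ)⁻¹ ∘ F = γ⁻¹`. -/
theorem IsWarp.rootAct_rootQuant_areaAct {γ f : ℝ → ℝ} (hγ : IsWarp γ) (hf : IsPosDensity f) :
    rootAct (cdfOf f) f (rootQuant (areaAct f γ)) =ᵐ[unitVol] srvf (warpInv γ) := by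
  have hd := hγ.hasDens_areaAct hf
  have he : EqOn (optWarp f (areaAct f γ)) (warpInv γ) (Icc 0 1) := by
    intro t ht
    have hFt := hf.bijOn_cdf.mapsTo ht
    rw [optWarp, Function.comp, ← warpInv_congr hd hd.eqOn hFt,
      warpInv_comp hf.hasDens hγ.hasDens hFt, Function.comp, hf.hasDens.invOn.1 ht]
  filter_upwards [hf.srvf_optWarp hd.isPosDensity,
    (hf.hasDens_optWarp hd.isPosDensity).warpDeriv_ae,
    ((hf.hasDens_optWarp hd.isPosDensity).congr he).warpDeriv_ae] with t h1 h2 h3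
  rw [← h1, srvf, srvf, h2, h3]

theorem norm_average_rootVec_sub {γ : ℕ → ℝ → ℝ} (hγ : ∀ i, IsWarp (γ i)) {f : ℝ → ℝ}
    (hf : IsPosDensity f) (β : ℝ) (n : ℕ) :
    ‖(n : ℝ)⁻¹ • (∑ i : Fin n, rootVec (areaAct f (γ i))) - β • rootVec f‖
      = l2Norm fun t => (n : ℝ)⁻¹ * ∑ i ∈ Finset.range n, srvf (warpInv (γ i)) t - β := by
  have hg : ∀ i : Fin n, IsPosDensity (areaAct f (γ i)) := fun i =>
    ((hγ i).hasDens_areaAct hf).isPosDensity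
  set ψ : ℝ → ℝ := fun s =>
    (n : ℝ)⁻¹ * ∑ i : Fin n, rootQuant (areaAct f (γ i)) s - β * rootQuant f s
  have hψ : AEMeasurable ψ unitVol :=
    ((memLp_sum_rootQuant hg).1.aemeasurable.const_mul _).sub
      (hf.aemeasurable_rootQuant.const_mul _)
  have h1 : ⇑((n : ℝ)⁻¹ • (∑ i : Fin n, rootVec (areaAct f (γ i))) - β • rootVec f)
      =ᵐ[unitVol] ψ := by
    filter_upwards [Lp.coeFn_sub ((n : ℝ)⁻¹ • (∑ i : Fin n, rootVec (areaAct f (γ i))))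
        (β • rootVec f), Lp.coeFn_smul (n : ℝ)⁻¹ (∑ i : Fin n, rootVec (areaAct f (γ i))),
      Lp.coeFn_smul β (rootVec f), coeFn_sum_rootVec hg, hf.coeFn_rootVec] with s a b c d e
    rw [a, Pi.sub_apply, b, c, Pi.smul_apply, Pi.smul_apply, d, e, smul_eq_mul, smul_eq_mul]
  have h2 : rootAct (cdfOf f) f ψ =ᵐ[unitVol] fun t =>
      (n : ℝ)⁻¹ * ∑ i ∈ Finset.range n, srvf (warpInv (γ i)) t - β := by
    filter_upwards [hf.rootAct_rootQuant,
      ae_all_iff.2 fun i => (hγ i).rootAct_rootQuant_areaAct hf] with t a b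
    rw [Finset.sum_range]
    simp_rw [← b]
    simp only [rootAct, ψ] at a ⊢
    rw [← Finset.mul_sum, mul_sub, mul_left_comm, mul_left_comm _ β, a, mul_one]
  rw [← l2Norm_congr_ae h2, l2Norm_eq_eLpNorm (hf.hasDens.aemeasurable_rootAct hψ),
    hf.hasDens.eLpNorm_rootAct hψ, Lp.norm_def, eLpNorm_congr_ae h1]

theorem tendsto_inv_norm_smul {H ι : Type*} [NormedAddCommGroup H] [NormedSpace ℝ H]
    {l : Filter ι} {u : ι → H} {x : H} (hu : Tendsto u l (𝓝 x)) (hx : x ≠ 0) :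
    Tendsto (fun i => ‖u i‖⁻¹ • u i) l (𝓝 (‖x‖⁻¹ • x)) :=
  (hu.norm.inv₀ (norm_ne_zero_iff.2 hx)).smul hu

/-- The distance from the density `f` to the Karcher mean of the warped densities. -/
def limitDist (f : ℝ → ℝ) (γ : ℕ → ℝ → ℝ) (n : ℕ) : ℝ :=
  ‖‖∑ i : Fin n, rootVec (areaAct f (γ i))‖⁻¹ • (∑ i : Fin n, rootVec (areaAct f (γ i)))
    - rootVec f‖

/-- Normalization is continuous away from `0` and blind to positive factors, so both `1 / n` and `β`
disappear. -/
theorem tendsto_limitDist {γ : ℕ → ℝ → ℝ} (hγ : ∀ i, IsWarp (γ i)) {f : ℝ → ℝ}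
    (hf : IsPosDensity f) {β : ℝ} (hβ : 0 < β)
    (h : Tendsto (fun n : ℕ => l2Norm fun t =>
      (n : ℝ)⁻¹ * ∑ i ∈ Finset.range n, srvf (warpInv (γ i)) t - β) atTop (𝓝 0)) :
    Tendsto (limitDist f γ) atTop (𝓝 0) := by
  simp_rw [← norm_average_rootVec_sub hγ hf β] at h
  have h1 := tendsto_iff_norm_sub_tendsto_zero.2 h
  have hne : β • rootVec f ≠ 0 := by
    rw [← norm_ne_zero_iff, norm_smul, hf.norm_rootVec, mul_one]
    exact norm_ne_zero_iff.2 hβ.ne'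
  have h2 := tendsto_inv_norm_smul h1 hne
  have h3 : ‖β • rootVec f‖⁻¹ • β • rootVec f = rootVec f := by
    rw [norm_smul, hf.norm_rootVec, mul_one, Real.norm_of_nonneg hβ.le, smul_smul,
      inv_mul_cancel₀ hβ.ne', one_smul]
  rw [h3] at h2
  refine (tendsto_iff_norm_sub_tendsto_zero.1 h2).congr' ?_
  filter_upwards [eventually_gt_atTop 0] with n hn
  have hn' : (0 : ℝ) < n := by exact_mod_cast hn
  rw [limitDist, norm_smul, Real.norm_of_nonneg (inv_pos.2 hn').le, mul_inv, inv_inv, smul_smul,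
    mul_right_comm, mul_inv_cancel₀ hn'.ne', one_mul]

/-- The starting index may vary with `m` because the root of the output does not depend on it. -/
theorem tendsto_dExt_karcherAlg {n : ℕ} (hn : 1 ≤ n) {G : ℕ → Fin n → ℝ → ℝ} {g : Fin n → ℝ → ℝ}
    {f : ℝ → ℝ} (hf : IsPosDensity f) (hg : ∀ i, IsPosDensity (g i))
    (hG : ∀ᶠ m in atTop, ∀ i, IsPosDensity (G m i))
    (hlim : ∀ i, Tendsto (fun m => ∫ t, |G m i t - g i t| ∂unitVol) atTop (𝓝 0))
    (j₀ : ℕ → Fin n) :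
    Tendsto (fun m => dExt (karcherAlg (G m) (j₀ m)) f) atTop
      (𝓝 ‖‖∑ i, rootVec (g i)‖⁻¹ • (∑ i, rootVec (g i)) - rootVec f‖) := by
  have h1 : Tendsto (fun m => ∑ i, rootVec (G m i)) atTop (𝓝 (∑ i, rootVec (g i))) :=
    tendsto_finsetSum _ fun i _ =>
      (hg i).tendsto_rootVec (hG.mono fun m hm => hm i) (hlim i)
  have hne : ∑ i, rootVec (g i) ≠ 0 :=
    norm_ne_zero_iff.1 (norm_sum_rootVec_pos hg ⟨0, hn⟩).ne'
  refine (((tendsto_inv_norm_smul h1 hne).sub_const (rootVec f)).norm).congr' ?_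
  filter_upwards [hG] with m hm
  rw [(hasDens_karcherAlg hm (j₀ m)).isPosDensity.dExt_eq_norm hf, rootVec_karcherAlg hm]

end

/-! ### Assembly on one almost sure event -/

theorem mainTheorem1
    {Ω : Type*} [MeasurableSpace Ω] (P : Measure Ω) [IsProbabilityMeasure P]
    -- the density `f`
    (f : ℝ → ℝ) (hf_cont : ContinuousOn f (Icc 0 1))
    (m_f M_f : ℝ) (hm_f : 0 < m_f) (hf_bdd : ∀ t ∈ Icc (0 : ℝ) 1, f t ∈ Icc m_f M_f)
    (hf_int : ∫ t in (0 : ℝ)..1, f t = 1)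
    -- the random warpings `γ i`
    (γ : ℕ → Ω → ℝ → ℝ) (hγ : ∀ i ω, IsWarp (γ i ω))
    (hγ_meas : ∀ i, Measurable (warpPath (γ i)))
    (hγ_indep : iIndepFun (fun i => warpPath (γ i)) P)
    (β : ℝ) (hβ : 0 < β)
    (hγ_mean : ∀ i, ∀ t ∈ Icc (0 : ℝ) 1, ∫ ω, srvf (warpInv (γ i ω)) t ∂P = β)
    (m_γ M_γ : ℝ) (hm_γ : 0 < m_γ)
    (hγ_bdd : ∀ i, ∀ᵐ ω ∂P, ∀ t ∈ Icc (0 : ℝ) 1, srvf (warpInv (γ i ω)) t ∈ Icc m_γ M_γ)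
    -- the total intensities; the underlying intensity is `lam m = Λ m * f`
    (Λ : ℕ → ℝ) (hΛ_pos : ∀ m, 0 < Λ m) (α : ℝ) (hα : 1 < α)
    (hΛ : ∀ᶠ m : ℕ in atTop, α * Real.log m ≤ Λ m)
    (lam : ℕ → ℝ → ℝ) (hlam : ∀ m t, lam m t = Λ m * f t)
    -- given `γ i`, the observation `S i m` is a Poisson process with intensity `(lam m; γ i)`
    (S : ℕ → ℕ → Ω → Multiset ℝ)
    (hS : ∀ i m, IsPoissonProcessGiven (warpSigma (γ i)) P (S i m)
      (fun ω => areaAct (lam m) (γ i ω)))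
    -- its event times form an initial segment of an i.i.d. sequence with density `(f; γ i)`
    (X : ℕ → ℕ → Ω → ℝ)
    (hX : ∀ i, IsIIDGiven (warpSigma (γ i)) P (X i) (fun ω => areaAct f (γ i ω)))
    (hSX : ∀ i m, ∀ᵐ ω ∂P,
      S i m ω = (Multiset.range (Multiset.card (S i m ω))).map (fun j => X i j ω))
    -- the kernel and the bandwidths
    (K : ℝ → ℝ) (hK_meas : Measurable K) (hK_nonneg : ∀ t, 0 ≤ K t)
    (hK_supp : ∀ t, 1 < |t| → K t = 0) (hK_int : ∫ t, K t = 1)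
    (h : ℕ → ℝ) (hh : Tendsto h atTop (𝓝 0))
    (hrh : Tendsto (fun r : ℕ => (r : ℝ) * h r) atTop atTop) :
    ∀ᵐ ω ∂P,
      -- the output of the algorithm is a Karcher mean of the estimated densities
      (∀ n : ℕ, 1 ≤ n → ∀ᶠ m in atTop, ∀ j₀ : Fin n,
        IsKarcherMean (fun i : Fin n => modifiedEst K h (S i m ω))
          (densityEst K h (fun i : Fin n => S i m ω) j₀)) ∧
      -- and the iterated limit exists and vanishes
      ∃ L : ℕ → ℝ,
        (∀ n : ℕ, 1 ≤ n → ∀ j₀ : ℕ → Fin n,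
          Tendsto (fun m => dExt (densityEst K h (fun i : Fin n => S i m ω) (j₀ m)) f)
            atTop (𝓝 (L n))) ∧
        Tendsto L atTop (𝓝 0) := by
  have hf : IsPosDensity f := by
    refine ⟨hf_cont.integrableOn_Icc, ?_, hf_int⟩
    filter_upwards [ae_mem_unit] with t ht using hm_f.trans_le (hf_bdd t ht).1
  have hfγ : ∀ i ω, HasDens (cdfOf f ∘ γ i ω) (areaAct f (γ i ω)) := fun i ω =>
    (hγ i ω).hasDens_areaAct hf
  have hK : Integrable K := by
    by_contra hc
    rw [integral_undef hc] at hK_int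
    exact zero_ne_one hK_int
  have hh_pos : ∀ᶠ r in atTop, 0 < h r := by
    filter_upwards [hrh.eventually_gt_atTop 0] with r hr
    exact pos_of_mul_pos_right hr (Nat.cast_nonneg r)
  have hcard : ∀ᵐ ω ∂P, ∀ i, Tendsto (fun m => Multiset.card (S i m ω)) atTop atTop := by
    rw [ae_all_iff]
    intro i
    refine ae_tendsto_card hΛ_pos hα hΛ fun m k =>
      (hS i m).measureReal_card_eq (hγ_meas i).comap_le (fun ω => ?_) k
    have : areaAct (lam m) (γ i ω) = fun t => Λ m * areaAct f (γ i ω) t := by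
      ext t; rw [areaAct, areaAct, hlam, mul_assoc]
    rw [this, integral_const_mul]
    have h1 := (hfγ i ω).isPosDensity.integral_eq_one
    rw [← integral_unitVol] at h1
    rw [h1, mul_one]
  have hmem : ∀ᵐ ω ∂P, ∀ i j, X i j ω ∈ Ioc (0 : ℝ) 1 := by
    rw [ae_all_iff]
    exact fun i => (hX i).ae_mem_Ioc (hγ_meas i) fun ω => (hfγ i ω).isPosDensity
  have hcdf : ∀ i, ∀ t ∈ Icc (0 : ℝ) 1,
      Measurable[warpSigma (γ i)] fun ω => cdfOf (areaAct f (γ i ω)) t := by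
    intro i t ht
    -- The distribution function of `(f; γ)` at `t` is `F (γ t)`; extending `F` continuously to the
    -- line makes it a Borel function of `γ t`.
    have h1 : (fun ω => cdfOf (areaAct f (γ i ω)) t)
        = fun ω => IccExtend zero_le_one ((Icc (0 : ℝ) 1).domRestrict (cdfOf f)) (γ i ω t) := by
      ext ω
      rw [← (hfγ i ω).eqOn ht, IccExtend_of_mem _ _ ((hγ i ω).hasDens.bijOn.mapsTo ht)]
      rfl
    rw [h1]
    have hF := continuousOn_iff_continuous_domRestrict.1 hf.continuousOn_cdf
    exact hF.Icc_extend'.measurable.comp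
      (measurable_warp_apply ht)
  have hdev : ∀ᵐ ω ∂P, ∀ i, ∀ p : ℕ, 0 < p → Tendsto (fun r =>
      cellDev (h r / p) (empMeasure (fun j => X i j ω) r) (densMeasure (areaAct f (γ i ω))))
      atTop (𝓝 0) := by
    simp_rw [ae_all_iff]
    intro i p hp
    have hp' : (0 : ℝ) < p := by exact_mod_cast hp
    refine (hX i).ae_tendsto_cellDev (hγ_meas i) (fun ω => (hfγ i ω).isPosDensity) (hcdf i) ?_ ?_
    · filter_upwards [hh_pos] with r hr using div_pos hr hp'
    · simp_rw [← mul_div_assoc]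
      exact hrh.atTop_div_const hp'
  have hM : 0 < M_γ := by
    obtain ⟨ω, hω⟩ := (hγ_bdd 0).exists
    have := hω 0 (by simp)
    exact hm_γ.trans_le (this.1.trans this.2)
  have hslln := ae_tendsto_l2Norm_average_srvf hγ hγ_meas hγ_indep hγ_mean hM fun i =>
    (hγ_bdd i).mono fun ω hω t ht => ⟨hm_γ.le.trans (hω t ht).1, (hω t ht).2⟩
  filter_upwards [hcard, hmem, hdev, hslln, ae_all_iff.2 fun i => ae_all_iff.2 fun m => hSX i m]
    with ω hcard hmem hdev hslln hSX
  have hx : ∀ i j, X i j ω ∈ Icc (0 : ℝ) 1 := fun i j => Ioc_subset_Icc_self (hmem i j)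
  have hpos : ∀ i, ∀ᶠ m in atTop, IsPosDensity (modifiedEst K h (S i m ω)) := by
    intro i
    have h1 : ∀ᶠ r in atTop, IsPosDensity
        (modifiedEst K h ((Multiset.range r).map fun j => X i j ω)) := by
      filter_upwards [hh_pos, hh.eventually (ge_mem_nhds zero_lt_one), eventually_gt_atTop 0]
        with r h1 h2 h3
      exact isPosDensity_modifiedEst hK hK_nonneg hK_int hK_supp (hx i) h3 h1 h2
    filter_upwards [(hcard i).eventually h1] with m hm
    rwa [hSX i m]
  have hL1 : ∀ i, Tendsto (fun m => ∫ t, |modifiedEst K h (S i m ω) t - areaAct f (γ i ω) t|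
      ∂unitVol) atTop (𝓝 0) := by
    intro i
    -- Convergence holds along the full sequence of sample sizes `r` for this `ω`, so random counts
    -- tending to infinity may be substituted whatever their dependence on the data.
    have h1 := (tendsto_integral_modifiedEst_sub hK_meas hK hK_nonneg hK_int hK_supp hh hh_pos
      (hx i) (hfγ i ω).isPosDensity (hdev i)).comp (hcard i)
    refine h1.congr fun m => ?_
    rw [Function.comp, ← hSX i m]
  have hpos' : ∀ n : ℕ, ∀ᶠ m in atTop, ∀ i : Fin n,
      IsPosDensity (modifiedEst K h (S i m ω)) := fun n =>
    eventually_all.2 fun i : Fin n => hpos i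
  refine ⟨fun n _ => ?_, limitDist f fun i => γ i ω, fun n hn j₀ => ?_, ?_⟩
  · filter_upwards [hpos' n] with m hm j₀
    exact isKarcherMean_karcherAlg hm j₀
  · exact tendsto_dExt_karcherAlg hn (G := fun m (i : Fin n) => modifiedEst K h (S i m ω)) hf
      (fun i : Fin n => (hfγ i ω).isPosDensity) (hpos' n) (fun i => hL1 i) j₀
  · exact tendsto_limitDist (fun i => hγ i ω) hf hβ hslln
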